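/- Theorem 1.10. Let $q$ be a prime, let $M\in\mathbb F_q^{k\times k}$ be a mixing matrix, and let $\mathcal C_{Y|Z}$ be a symmetric memoryless channel with input alphabet $\mathbb F_q$. Then the Arıkan martingale associated with $(M,\mathcal C_{Y|Z})$ is locally polarizing. Here the notions are as follows. *Mixing.* $M$ is invertible and for every permutation $\pi$ of $[k]$ there are $i,j\in[k]$ with $j<\pi(i)$ and $M_{i,j}\neq0$; that is, no permutation of the rows of $M$ is upper triangular. *Symmetric channel.* The channel is given by discrete probability distributions $(\mathcal C(\cdot\mid a))_{a\in\mathbb F_q}$ on an output alphabet $\mathcal Y$ such that for all $a,b\in\mathbb F_q$ there is a bijection $\sigma:\mathcal Y\to\mathcal Y$ with $\mathcal C(y\mid a)=\mathcal C(\sigma(y)\mid b)$ for all $y\in\mathcal{Y}$, and such that $\sum_{x\in\mathbb F_q}\mathcal C(y\mid x)$ does not depend on $y\in\mathcal{Y}$. It is memoryless: it acts independently and identically on each coordinate of its input. *Arıkan martingale.* Distributions $D_t$ on pairs $(\mathbf A,\mathbf B)\in\mathbb F_q^{k^t}\times\mathcal Y^{k^t}$, with coordinates indexed by $[k]^t$,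 are defined inductively. For $(A,B)\sim D_0$, $A$ is uniform on $\mathbb F_q$ and $B\sim\mathcal C(\cdot\mid A)$. For $t\ge1$, take independent samples $(\mathbf A^{(1)},\mathbf B^{(1)}),\dots,(\mathbf A^{(k)},\mathbf B^{(k)})\sim D_{t-1}$; then $D_t$ is the law of $(\mathbf A',\mathbf B')$, where $(\mathbf A'_{[\mathbf i,1]},\dots,\mathbf A'_{[\mathbf i,k]})=(\mathbf A^{(1)}_{\mathbf i},\dots,\mathbf A^{(k)}_{\mathbf i})\cdot M$ for all $\mathbf i\in[k]^{t-1}$, and $\mathbf B'=(\mathbf B^{(1)},\dots,\mathbf B^{(k)})$. Let $i_1,i_2,\dots$ be independent and uniform on $[k]$. With $\mathbf j=(i_1,\dots,i_t)$, $$X_t:=\frac{H(\mathbf A_{\mathbf j}\mid \mathbf A_{\prec\mathbf j},\mathbf B)}{\log_2 q},$$ where the conditional entropy (in bits) is taken with respect to $(\mathbf A,\mathbf B)\sim D_t$, with $\mathbf j$ held fixed, and $\prec$ is the lexicographic order on $[k]^t$. *Locally polarizing.* $X_0,X_1,\dots$ is a $[0,1]$-valued martingale such that: 1. (Variance in the middle)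 for every $\tau>0$ there is $\theta>0$ such that for all $j\geq 0$: if $X_j\in(\tau,1-\tau)$ then $\mathbb E[(X_{j+1}-X_j)^2\mid X_j]\ge\theta$; 2. (Suction at the ends) there is $\alpha>0$ such that for every $0<c<\infty$ there is $\tau>0$ such that for all $j\geq 0$: if $X_j\le\tau$ then $\Pr[X_{j+1}\le X_j/c\mid X_j]\ge\alpha$, and if $1-X_j\le\tau$ then $\Pr[1-X_{j+1}\le(1-X_j)/c\mid X_j]\ge\alpha$. -/

import Mathlib

open MeasureTheory ProbabilityTheory

noncomputable section

namespace Polar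

/-! ### `[0,1]`-martingales and local polarization -/

/-- `X₀, X₁, …` takes values in `[0,1]` and is a martingale with respect to its own past:
`E[X_{t+1} | X₀, …, X_t] = X_t`. -/
def IsUnitMartingale {Ω : Type*} [MeasurableSpace Ω] (μ : Measure Ω) (X : ℕ → Ω → ℝ) : Prop :=
  (∀ t ω, X t ω ∈ Set.Icc (0 : ℝ) 1) ∧
    ∃ hX : ∀ t, StronglyMeasurable (X t), Martingale X (Filtration.natural X hX) μ

/-- `E[f | Z]`, the conditional expectation of `f` given the real random variable `Z`. -/
def condExpGiven {Ω : Type*} [MeasurableSpace Ω] (μ : Measure Ω) (f : Ω → ℝ) (Z : Ω → ℝ) :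
    Ω → ℝ :=
  μ[f | MeasurableSpace.comap Z inferInstance]

/-- `Pr[E | Z]`, the conditional probability of the event `E` given the real random
variable `Z`. -/
def condProbGiven {Ω : Type*} [MeasurableSpace Ω] (μ : Measure Ω) (E : Set Ω) (Z : Ω → ℝ) :
    Ω → ℝ :=
  condExpGiven μ (E.indicator fun _ => 1) Z

/-- Variance in the middle: for every `τ > 0` there is `θ > 0` such that for all `j`, if
`X_j ∈ (τ, 1 - τ)` then `E[(X_{j+1} - X_j)² | X_j] ≥ θ`. -/
def VarianceInTheMiddle {Ω : Type*} [MeasurableSpace Ω] (μ : Measure Ω) (X : ℕ → Ω → ℝ) :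
    Prop :=
  ∀ τ : ℝ, 0 < τ → ∃ θ : ℝ, 0 < θ ∧ ∀ j : ℕ, ∀ᵐ ω ∂μ,
    X j ω ∈ Set.Ioo τ (1 - τ) →
      θ ≤ condExpGiven μ (fun ω' => (X (j + 1) ω' - X j ω') ^ 2) (X j) ω

/-- Suction at the ends: there is `α > 0` such that for all `c` there is `τ > 0` such that, for
all `j`, if `X_j ≤ τ` then `Pr[X_{j+1} ≤ X_j / c | X_j] ≥ α`, and if `1 - X_j ≤ τ` then
`Pr[1 - X_{j+1} ≤ (1 - X_j) / c | X_j] ≥ α`. -/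
def SuctionAtTheEnds {Ω : Type*} [MeasurableSpace Ω] (μ : Measure Ω) (X : ℕ → Ω → ℝ) : Prop :=
  ∃ α : ℝ, 0 < α ∧ ∀ c : ℝ, 0 < c → ∃ τ : ℝ, 0 < τ ∧ ∀ j : ℕ,
    (∀ᵐ ω ∂μ, X j ω ≤ τ →
      α ≤ condProbGiven μ {ω' | X (j + 1) ω' ≤ X j ω' / c} (X j) ω) ∧
    (∀ᵐ ω ∂μ, 1 - X j ω ≤ τ →
      α ≤ condProbGiven μ {ω' | 1 - X (j + 1) ω' ≤ (1 - X j ω') / c} (X j) ω)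

/-- A locally polarizing `[0,1]`-martingale. -/
def LocallyPolarizing {Ω : Type*} [MeasurableSpace Ω] (μ : Measure Ω) (X : ℕ → Ω → ℝ) : Prop :=
  IsUnitMartingale μ X ∧ VarianceInTheMiddle μ X ∧ SuctionAtTheEnds μ X

/-! ### Discrete distributions and conditional entropy -/

theorem tsum_prod_eq_one {α : Type*} (p : PMF α) :
    ∀ k : ℕ, ∑' v : Fin k → α, ∏ i, p (v i) = 1
  | 0 => by simp
  | k + 1 => by
    rw [← (Fin.consEquiv fun _ : Fin (k + 1) => α).tsum_eq
      (fun v : Fin (k + 1) → α => ∏ i, p (v i)), ENNReal.tsum_prod']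
    simp only [Fin.consEquiv, Equiv.coe_fn_mk, Fin.prod_univ_succ, Fin.cons_zero, Fin.cons_succ]
    simp only [ENNReal.tsum_mul_left, tsum_prod_eq_one p k, mul_one, p.tsum_coe]

/-- The law of `k` independent samples from `p`. -/
def iid {α : Type*} (k : ℕ) (p : PMF α) : PMF (Fin k → α) :=
  ⟨fun v => ∏ i, p (v i), by rw [← tsum_prod_eq_one p k]; exact ENNReal.summable.hasSum⟩

/-- The probability of the event `E` under the discrete law `p`. -/
def prob {S : Type*} (p : PMF S) (E : Set S) : ℝ :=
  (p.toOuterMeasure E).toReal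

/-- `Pr[X = x | Y = y]` under the discrete law `p`. -/
def condProb {S α β : Type*} (p : PMF S) (X : S → α) (Y : S → β) (x : α) (y : β) : ℝ :=
  prob p {s | X s = x ∧ Y s = y} / prob p {s | Y s = y}

/-- The conditional entropy `H(X | Y) = E_y H(X | Y = y)`, in bits, of a finitely valued `X`
given `Y`, for a sample drawn from the discrete law `p`. -/
def condEntropy {S α β : Type*} [Fintype α] (p : PMF S) (X : S → α) (Y : S → β) : ℝ :=
  ∑' y, prob p {s | Y s = y} *
    ∑ x, condProb p X Y x y * Real.logb 2 (1 / condProb p X Y x y)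

/-! ### Channels and mixing matrices -/

/-- A memoryless channel with input alphabet `F` and (discrete) output alphabet `𝒴` is given by
the output laws `C a`, `a ∈ F`. It is symmetric if any two of these laws differ by a permutation of
the outputs, and moreover `∑ₓ C(y | x)` does not depend on `y`. -/
def IsSymmetricChannel {F 𝒴 : Type*} [Fintype F] (C : F → PMF 𝒴) : Prop :=
  (∀ a b : F, ∃ σ : Equiv.Perm 𝒴, ∀ y, C a y = C b (σ y)) ∧
    ∀ y₁ y₂ : 𝒴, ∑ x, C x y₁ = ∑ x, C x y₂

/-- `M` is invertible, and no permutation of its rows (sending row `i` to position `π i`) makes it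
upper triangular. -/
def IsMixing {F : Type*} [Field F] {k : ℕ} (M : Matrix (Fin k) (Fin k) F) : Prop :=
  IsUnit M ∧ ∀ π : Equiv.Perm (Fin k), ∃ i j : Fin k, j < π i ∧ M i j ≠ 0

/-! ### The Arıkan martingale -/

/-- Multi-indices in `[k]^t`. -/
abbrev MultiIndex (k t : ℕ) : Type := Fin t → Fin k

/-- One step of the construction, on `k` samples `(A⁽¹⁾, B⁽¹⁾), …, (A⁽ᵏ⁾, B⁽ᵏ⁾)`:
`A'_{[i, ·]} = (A⁽¹⁾_i, …, A⁽ᵏ⁾_i) · M` for every `i ∈ [k]^t`, and `B' = (B⁽¹⁾, …, B⁽ᵏ⁾)`, that is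
`B'_{[s, i]} = B⁽ˢ⁾_i`. -/
def arikanStep {F 𝒴 : Type*} [Field F] {k : ℕ} (M : Matrix (Fin k) (Fin k) F) (t : ℕ)
    (v : Fin k → (MultiIndex k t → F) × (MultiIndex k t → 𝒴)) :
    (MultiIndex k (t + 1) → F) × (MultiIndex k (t + 1) → 𝒴) :=
  (fun m => Matrix.vecMul (fun s => (v s).1 (Fin.init m)) M (m (Fin.last t)),
    fun m => (v (m 0)).2 (Fin.tail m))

/-- The law `D_t` on `F^{k^t} × 𝒴^{k^t}`. For `t = 0`, `A` is uniform on `F` and `B` is drawn from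
the channel with input `A`; a sample from `D_{t+1}` is obtained from `k` independent samples from
`D_t` by `arikanStep`. -/
def arikanLaw {F 𝒴 : Type*} [Field F] [Fintype F] {k : ℕ} (M : Matrix (Fin k) (Fin k) F)
    (C : F → PMF 𝒴) : (t : ℕ) → PMF ((MultiIndex k t → F) × (MultiIndex k t → 𝒴))
  | 0 => (PMF.uniformOfFintype F).bind fun a => (C a).map fun y => (fun _ => a, fun _ => y)
  | t + 1 => (iid k (arikanLaw M C t)).map (arikanStep M t)

/-- `H(A_j | A_{≺ j}, B) / log₂ |F|` for `(A, B) ∼ D_t`, where `≺` is the lexicographic order on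
`[k]^t`. -/
def arikanEntropy {F 𝒴 : Type*} [Field F] [Fintype F] {k : ℕ} (M : Matrix (Fin k) (Fin k) F)
    (C : F → PMF 𝒴) (t : ℕ) (j : MultiIndex k t) : ℝ :=
  condEntropy (arikanLaw M C t) (fun AB => AB.1 j)
      (fun AB => (fun m : {m : MultiIndex k t // toLex m < toLex j} => AB.1 m, AB.2)) /
    Real.logb 2 (Fintype.card F)

/-- `i₁, i₂, …` (here `i 0, i 1, …`) are independent and uniform on `[k]`. -/
def IsUniformIID {Ω : Type*} [MeasurableSpace Ω] (μ : Measure Ω) {k : ℕ} (i : ℕ → Ω → Fin k) :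
    Prop :=
  (∀ t, Measurable (i t)) ∧ iIndepFun i μ ∧
    ∀ t s, μ {ω | i t ω = s} = (k : ENNReal)⁻¹

/-- The Arıkan martingale `X_t = H(A_j | A_{≺ j}, B) / log₂ |F|` with `j = (i₁, …, i_t)`, driven
by the random indices `i₁, i₂, …`. -/
def arikanMartingale {F 𝒴 Ω : Type*} [Field F] [Fintype F] {k : ℕ}
    (M : Matrix (Fin k) (Fin k) F) (C : F → PMF 𝒴) (i : ℕ → Ω → Fin k) (t : ℕ) (ω : Ω) : ℝ :=
  arikanEntropy M C t fun s => i s ω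

end Polar

end

/-! Fix a prefix `j` of indices and put `A = A_j`, `W = (A_{≺ j}, B)`. The next step takes `k`
independent copies of `(A, W)`, sets `U = A M`, and replaces `H(A | W)` by `H(U_s | U_{<s}, W)` for
a uniform `s`. As `M` is invertible, the chain rule makes the average over `s` equal to `H(A | W)`,
which is the martingale property (`sum_stepEnt`).

Mixing makes some step compare with `H₂ = H(A + α A' | W, W')`, where `(A', W')` is an independent
copy and `α ≠ 0`. Two rows of `M` have their first nonzero entry in the same column `s`; revealing
all other samples gives `H(U_s | U_{<s}, W) ≥ H₂` (`pairEnt_le_stepEnt`). Dually, two columns of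
`M⁻¹` have their last nonzero entry in the same row `s`, and then `H(U_s | U_{<s}, W) ≤ 2 H(A | W) -
H₂` (`stepEnt_le`), in general for another `s` and `α`.

Three estimates on convolutions on `ℤ/q`, averaged over the side information, finish the argument.
In the middle, `H₂` exceeds `H(A | W)` by a fixed amount, by strict concavity, compactness and the
primality of `q`. Near `log q`, the deficit of `H₂` is at most a constant times the square of the
deficit of `H(A | W)`, by an `L²` bound. Near `0`, `2 H(A | W) - H₂` is at most any prescribed
fraction of `H(A | W)`, because a law of small entropy has an error probability of smaller order
than its entropy. All constants are independent of `t` and `j`, and the good index `s` is drawn with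
probability `1/k`. -/

noncomputable section
namespace Polar

/-! ### Entropy of functions on a finite weighted set -/

section Entropy

variable {S T γ δ ε ι : Type*} [Fintype S] [Fintype T]

open Classical in
/-- The mass of the fibre of `Z` over `z`. -/
def mass (w : S → ℝ) (Z : S → γ) (z : γ) : ℝ := ∑ s, if Z s = z then w s else 0

/-- The Shannon entropy, in nats, of `Z` under the weights `w`. -/
def ent (w : S → ℝ) (Z : S → γ) : ℝ := ∑ s, w s * -Real.log (mass w Z (Z s))

/-- The conditional Shannon entropy, in nats, of `X` given `Y` under the weights `w`. -/
def cent (w : S → ℝ) (X : S → γ) (Y : S → δ) : ℝ := ent w (fun s => (X s, Y s)) - ent w Y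

/-- The Shannon entropy, in nats, of a probability vector. -/
def shannon {F : Type*} [Fintype F] (p : F → ℝ) : ℝ := ∑ a, Real.negMulLog (p a)

theorem mass_eq [DecidableEq γ] (w : S → ℝ) (Z : S → γ) (z : γ) :
    mass w Z z = ∑ s, if Z s = z then w s else 0 := by
  unfold mass
  exact Finset.sum_congr rfl fun s _ => by congr

theorem mass_nonneg {w : S → ℝ} (hw : ∀ s, 0 ≤ w s) (Z : S → γ) (z : γ) : 0 ≤ mass w Z z :=
  Finset.sum_nonneg fun s _ => by split_ifs; exacts [hw s, le_rfl]

theorem le_mass {w : S → ℝ} (hw : ∀ s, 0 ≤ w s) (Z : S → γ) (s : S) : w s ≤ mass w Z (Z s) := by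
  classical
  have := Finset.single_le_sum (f := fun s' => if Z s' = Z s then w s' else 0)
    (fun s' _ => by split_ifs; exacts [hw s', le_rfl]) (Finset.mem_univ s)
  simpa [mass] using this

theorem sum_mul_comp [Fintype γ] (w : S → ℝ) (Z : S → γ) (G : γ → ℝ) :
    ∑ s, w s * G (Z s) = ∑ z, mass w Z z * G z := by
  classical
  simp only [mass, Finset.sum_mul]
  rw [Finset.sum_comm]
  refine Finset.sum_congr rfl fun s _ => ?_
  simp [ite_mul]

theorem ent_eq_sum [Fintype γ] (w : S → ℝ) (Z : S → γ) :
    ent w Z = ∑ z, Real.negMulLog (mass w Z z) := by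
  unfold ent
  rw [sum_mul_comp w Z fun z => -Real.log (mass w Z z)]
  simp [Real.negMulLog]

theorem mass_congr (w : S → ℝ) {Z : S → γ} {Z' : S → δ} (h : ∀ s s', Z s = Z s' ↔ Z' s = Z' s')
    (s : S) : mass w Z (Z s) = mass w Z' (Z' s) := by
  classical
  unfold mass
  exact Finset.sum_congr rfl fun s' _ => if_congr (h s' s) rfl rfl

/-- Functions with the same fibres have the same entropy. -/
theorem ent_congr (w : S → ℝ) {Z : S → γ} {Z' : S → δ}
    (h : ∀ s s', Z s = Z s' ↔ Z' s = Z' s') : ent w Z = ent w Z' :=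
  Finset.sum_congr rfl fun s _ => by rw [mass_congr w h s]

/-- Only fibres matter, and those of `X` only inside a fibre of `Y`. This allows a change of
variable in `X` that depends on `Y`. -/
theorem cent_congr (w : S → ℝ) {X : S → γ} {Y : S → δ} {X' : S → ε} {Y' : S → ι}
    (hY : ∀ s s', Y s = Y s' ↔ Y' s = Y' s')
    (hX : ∀ s s', Y s = Y s' → (X s = X s' ↔ X' s = X' s')) : cent w X Y = cent w X' Y' := by
  unfold cent
  rw [ent_congr w hY, ent_congr w (Z := fun s => (X s, Y s)) (Z' := fun s => (X' s, Y' s))]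
  intro s s'
  simp only [Prod.mk.injEq, ← hY]
  exact and_congr_left fun h => hX s s' h

theorem sum_mass_prod [Fintype γ] (w : S → ℝ) (X : S → γ) (Y : S → δ) (y : δ) :
    ∑ x, mass w (fun s => (X s, Y s)) (x, y) = mass w Y y := by
  classical
  unfold mass
  rw [Finset.sum_comm]
  refine Finset.sum_congr rfl fun s _ => ?_
  by_cases h : Y s = y <;> simp [h]

theorem sum_mass [Fintype γ] (w : S → ℝ) (Z : S → γ) : ∑ z, mass w Z z = ∑ s, w s := by
  simpa using (sum_mul_comp w Z fun _ => 1).symm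

/-- Conditioning on more reduces entropy. -/
theorem cent_anti [Fintype γ] [Fintype δ] {w : S → ℝ} (hw : ∀ s, 0 ≤ w s) (X : S → γ)
    (Y : S → δ) (Y' : S → ε) (h : ∀ s s', Y s = Y s' → Y' s = Y' s') :
    cent w X Y ≤ cent w X Y' := by
  classical
  rcases isEmpty_or_nonempty S with hS | hS
  · simp [cent, ent]
  obtain ⟨g, hg⟩ : ∃ g : δ → ε, ∀ s, Y' s = g (Y s) :=
    ⟨fun y => Y' (Function.invFun Y y), fun s =>
      h _ _ (Function.invFun_eq (f := Y) ⟨s, rfl⟩).symm⟩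
  set a := mass w (fun s => (X s, Y s)) with ha
  set b := mass w Y with hb
  set a' := mass w (fun s => (X s, Y' s)) with ha'
  set b' := mass w Y' with hb'
  -- Gibbs' inequality: `log r ≤ r - 1` at the ratio `r = P(x | y') / P(x | y)`, whose mean is at
  -- most `1`.
  have key : ∀ s, w s * (-Real.log (a (X s, Y s)) - -Real.log (b (Y s)) -
      (-Real.log (a' (X s, Y' s)) - -Real.log (b' (Y' s)))) ≤
      w s * (b (Y s) * a' (X s, g (Y s)) / (a (X s, Y s) * b' (g (Y s)))) - w s := by
    intro s
    rcases (hw s).eq_or_lt with h0 | h0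
    · simp [← h0]
    have h1 : 0 < a (X s, Y s) := h0.trans_le (le_mass hw (fun s => (X s, Y s)) s)
    have h2 : 0 < b (Y s) := h0.trans_le (le_mass hw Y s)
    have h3 : 0 < a' (X s, Y' s) := h0.trans_le (le_mass hw (fun s => (X s, Y' s)) s)
    have h4 : 0 < b' (Y' s) := h0.trans_le (le_mass hw Y' s)
    rw [← hg]
    have h5 := Real.log_le_sub_one_of_pos (div_pos (mul_pos h2 h3) (mul_pos h1 h4))
    rw [Real.log_div (by positivity) (by positivity), Real.log_mul h2.ne' h3.ne',
      Real.log_mul h1.ne' h4.ne'] at h5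
    nlinarith
  have hsum : ∑ s, w s * (b (Y s) * a' (X s, g (Y s)) / (a (X s, Y s) * b' (g (Y s)))) ≤
      ∑ s, w s := by
    rw [sum_mul_comp w (fun s => (X s, Y s))
      fun z => b z.2 * a' (z.1, g z.2) / (a z * b' (g z.2)), ← sum_mass w Y, Fintype.sum_prod_type,
      Finset.sum_comm]
    refine Finset.sum_le_sum fun y _ => ?_
    have hb0 : 0 ≤ b y := mass_nonneg hw _ _
    have hb0' : 0 ≤ b' (g y) := mass_nonneg hw _ _
    calc _ ≤ ∑ x, b y * (a' (x, g y) / b' (g y)) := by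
          refine Finset.sum_le_sum fun x _ => ?_
          have ha0 : 0 ≤ a (x, y) := mass_nonneg hw _ _
          have ha0' : 0 ≤ a' (x, g y) := mass_nonneg hw _ _
          change a (x, y) * (b y * a' (x, g y) / (a (x, y) * b' (g y))) ≤ _
          rcases ha0.eq_or_lt with h0 | h0
          · rw [← h0, zero_mul]; positivity
          · apply le_of_eq
            rw [← mul_div_assoc, mul_div_mul_left _ _ h0.ne', mul_div_assoc]
      _ = b y * (b' (g y) / b' (g y)) := by
          rw [← Finset.mul_sum, ← Finset.sum_div, ha', sum_mass_prod]
      _ ≤ b y := mul_le_of_le_one_right hb0 (div_self_le_one _)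
  have := Finset.sum_le_sum fun s (_ : s ∈ Finset.univ) => key s
  rw [Finset.sum_sub_distrib] at this
  simp only [mul_sub, Finset.sum_sub_distrib] at this
  unfold cent ent
  linarith

/-- Entropy is additive over independent functions. -/
theorem ent_prod_of_indep {w : S → ℝ} (hw : ∀ s, 0 ≤ w s) (X : S → γ) (Y : S → δ)
    (h : ∀ s, mass w (fun s => (X s, Y s)) (X s, Y s) = mass w X (X s) * mass w Y (Y s)) :
    ent w (fun s => (X s, Y s)) = ent w X + ent w Y := by
  unfold ent
  rw [← Finset.sum_add_distrib]
  refine Finset.sum_congr rfl fun s _ => ?_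
  rcases (hw s).eq_or_lt with h0 | h0
  · simp [← h0]
  have h2 : 0 < mass w X (X s) := h0.trans_le (le_mass hw X s)
  have h3 : 0 < mass w Y (Y s) := h0.trans_le (le_mass hw Y s)
  rw [h s, Real.log_mul h2.ne' h3.ne']
  ring

theorem mass_comp (w : S → ℝ) (f : S → T) (Z : T → γ) :
    mass w (fun s => Z (f s)) = mass (mass w f) Z := by
  classical
  funext z
  have := sum_mul_comp w f fun t => if Z t = z then 1 else 0
  simpa [mass] using this

/-- The entropy of `Z ∘ f` is the entropy of `Z` under the image weights. -/
theorem ent_comp (w : S → ℝ) (f : S → T) (Z : T → γ) :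
    ent w (fun s => Z (f s)) = ent (mass w f) Z := by
  unfold ent
  rw [mass_comp, sum_mul_comp w f fun t => -Real.log (mass (mass w f) Z (Z t))]

theorem cent_comp (w : S → ℝ) (f : S → T) (X : T → γ) (Y : T → δ) :
    cent w (fun s => X (f s)) (fun s => Y (f s)) = cent (mass w f) X Y := by
  unfold cent
  rw [ent_comp, ent_comp w f fun t => (X t, Y t)]

/-- The conditional entropy is the average of the entropies of the conditional laws. -/
theorem cent_eq_sum_shannon [Fintype γ] [Fintype δ] (w : S → ℝ) (X : S → γ) (Y : S → δ)
    (p : δ → γ → ℝ) (hp : ∀ y, ∑ x, p y x = 1)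
    (h : ∀ x y, mass w (fun s => (X s, Y s)) (x, y) = mass w Y y * p y x) :
    cent w X Y = ∑ y, mass w Y y * shannon (p y) := by
  unfold cent
  rw [ent_eq_sum, ent_eq_sum, Fintype.sum_prod_type, Finset.sum_comm, ← Finset.sum_sub_distrib]
  refine Finset.sum_congr rfl fun y _ => ?_
  simp only [h, Real.negMulLog_mul, Finset.sum_add_distrib, ← Finset.sum_mul, ← Finset.mul_sum, hp]
  rw [shannon]
  ring

/-- The conditional law of `X` given `Y`. A point mass serves at values of mass zero, so that later
estimates hold for every `y` without exception. -/
theorem exists_kernel [Fintype γ] [Nonempty γ] {w : S → ℝ} (hw : ∀ s, 0 ≤ w s) (X : S → γ)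
    (Y : S → δ) : ∃ p : δ → γ → ℝ, (∀ y, p y ∈ stdSimplex ℝ γ) ∧
      ∀ x y, mass w (fun s => (X s, Y s)) (x, y) = mass w Y y * p y x := by
  classical
  have : ∀ y, ∃ p : γ → ℝ, p ∈ stdSimplex ℝ γ ∧
      ∀ x, mass w (fun s => (X s, Y s)) (x, y) = mass w Y y * p x := by
    intro y
    rcases (mass_nonneg hw Y y).eq_or_lt with h0 | h0
    · obtain ⟨x₀⟩ := ‹Nonempty γ›
      refine ⟨Pi.single x₀ 1, single_mem_stdSimplex ℝ x₀, fun x => ?_⟩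
      rw [← h0, zero_mul]
      have h1 := sum_mass_prod w X Y y
      rw [← h0, Finset.sum_eq_zero_iff_of_nonneg fun x _ => mass_nonneg hw _ _] at h1
      exact h1 x (Finset.mem_univ x)
    · refine ⟨fun x => mass w (fun s => (X s, Y s)) (x, y) / mass w Y y,
        ⟨fun x => div_nonneg (mass_nonneg hw _ _) h0.le, ?_⟩, fun x => ?_⟩
      · rw [← Finset.sum_div, sum_mass_prod, div_self h0.ne']
      · rw [mul_div_cancel₀ _ h0.ne']
  choose p hp using this
  exact ⟨p, fun y => (hp y).1, fun x y => (hp y).2 x⟩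

end Entropy

/-! ### Independent samples -/

section IID

variable {S γ δ : Type*} [Fintype S] {k : ℕ}

/-- The weights of `k` independent samples. -/
def iidWeight (k : ℕ) (w : S → ℝ) (v : Fin k → S) : ℝ := ∏ r, w (v r)

theorem iidWeight_nonneg {S : Type*} {k : ℕ} {w : S → ℝ} (hw : ∀ s, 0 ≤ w s) (v : Fin k → S) : 0 ≤ iidWeight k w v :=
  Finset.prod_nonneg fun _ _ => hw _

theorem sum_iidWeight_mul_prod (w : S → ℝ) (f : Fin k → S → ℝ) :
    ∑ v, iidWeight k w v * ∏ r, f r (v r) = ∏ r, ∑ s, w s * f r s := by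
  simp only [iidWeight, ← Finset.prod_mul_distrib]
  rw [Fintype.prod_sum]

theorem mass_iidWeight_pi (w : S → ℝ) (Z : S → γ) (z : Fin k → γ) :
    mass (iidWeight k w) (fun v r => Z (v r)) z = ∏ r, mass w Z (z r) := by
  classical
  have := sum_iidWeight_mul_prod w fun (r : Fin k) s => if Z s = z r then 1 else 0
  simp only [mul_ite, mul_one, mul_zero] at this
  simp only [mass, ← this]
  refine Finset.sum_congr rfl fun v _ => ?_
  simp [Finset.prod_ite_zero, funext_iff]

theorem ent_iidWeight_pi {w : S → ℝ} (hw : ∀ s, 0 ≤ w s) (hw1 : ∑ s, w s = 1) (Z : S → γ) :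
    ent (iidWeight k w) (fun v r => Z (v r)) = k * ent w Z := by
  classical
  unfold ent
  have h1 : ∀ v, iidWeight k w v *
      -Real.log (mass (iidWeight k w) (fun v r => Z (v r)) (fun r => Z (v r))) =
      ∑ r, iidWeight k w v * -Real.log (mass w Z (Z (v r))) := by
    intro v
    rcases (iidWeight_nonneg hw v).eq_or_lt with h0 | h0
    · simp [← h0]
    rw [mass_iidWeight_pi, Real.log_prod, ← Finset.sum_neg_distrib, Finset.mul_sum]
    intro r _
    have : w (v r) ≠ 0 := fun h => h0.ne' (Finset.prod_eq_zero (Finset.mem_univ r) h)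
    exact (((hw _).lt_of_ne' this).trans_le (le_mass hw Z _)).ne'
  rw [Finset.sum_congr rfl fun v _ => h1 v, Finset.sum_comm]
  have h2 : ∀ r : Fin k, ∑ v, iidWeight k w v * -Real.log (mass w Z (Z (v r))) =
      ∑ s, w s * -Real.log (mass w Z (Z s)) := by
    intro r
    have := sum_iidWeight_mul_prod (k := k) w
      fun r' s => if r' = r then -Real.log (mass w Z (Z s)) else 1
    simp only [Finset.prod_ite_eq', Finset.mem_univ, if_true] at this
    rw [this, Finset.prod_eq_single r]
    · simp
    · intro r' _ h
      simp [h, hw1]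
    · simp
  rw [Finset.sum_congr rfl fun r _ => h2 r, Finset.sum_const, Finset.card_univ, Fintype.card_fin,
    nsmul_eq_mul]

/-- The weights of two independent samples. -/
def pairWeight (w : S → ℝ) (z : S × S) : ℝ := w z.1 * w z.2

/-- Fubini for an integrand that couples the samples `i` and `j` and factors over the others. -/
theorem sum_iidWeight_pair (w : S → ℝ) (f : Fin k → S → ℝ) (g : S → S → ℝ) {i j : Fin k}
    (hij : i ≠ j) (hi : f i = 1) (hj : f j = 1) :
    ∑ v, iidWeight k w v * (g (v i) (v j) * ∏ r, f r (v r)) =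
      (∑ s, ∑ t, w s * w t * g s t) * ∏ r ∈ {i, j}ᶜ, ∑ s, w s * f r s := by
  classical
  -- Expanding `g` over the values `(s, t)` of the pair leaves full products, to which
  -- `sum_iidWeight_mul_prod` applies.
  have h1 : ∀ v : Fin k → S, g (v i) (v j) * ∏ r, f r (v r) =
      ∑ s, ∑ t, g s t * ∏ r, (if r = i then (if v r = s then 1 else 0) else
        if r = j then (if v r = t then 1 else 0) else f r (v r)) := by
    intro v
    have h2 : ∀ s t, ∏ r, (if r = i then (if v r = s then (1 : ℝ) else 0) else
        if r = j then (if v r = t then 1 else 0) else f r (v r)) =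
        (if v i = s then 1 else 0) * ((if v j = t then 1 else 0) * ∏ r, f r (v r)) := by
      intro s t
      rw [← Finset.mul_prod_erase _ _ (Finset.mem_univ i),
        ← Finset.mul_prod_erase _ _ (Finset.mem_erase.2 ⟨hij.symm, Finset.mem_univ j⟩),
        ← Finset.mul_prod_erase (a := i) Finset.univ (fun r => f r (v r)) (Finset.mem_univ i),
        ← Finset.mul_prod_erase (a := j) (Finset.univ.erase i) (fun r => f r (v r))
          (Finset.mem_erase.2 ⟨hij.symm, Finset.mem_univ j⟩)]
      rw [hi, hj]
      simp only [if_true, if_neg hij.symm, Pi.one_apply, one_mul]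
      congr 2
      refine Finset.prod_congr rfl fun r hr => ?_
      simp only [Finset.mem_erase] at hr
      rw [if_neg hr.2.1, if_neg hr.1]
    simp only [h2]
    simp
  simp only [h1, Finset.mul_sum]
  rw [Finset.sum_comm, Finset.sum_mul]
  refine Finset.sum_congr rfl fun s _ => ?_
  rw [Finset.sum_comm, Finset.sum_mul]
  refine Finset.sum_congr rfl fun t _ => ?_
  simp only [mul_left_comm _ (g s t) _]
  rw [← Finset.mul_sum, sum_iidWeight_mul_prod w (fun r s' =>
    if r = i then (if s' = s then 1 else 0) else if r = j then (if s' = t then 1 else 0) else f r s'),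
    ← Finset.prod_mul_prod_compl {i, j}, Finset.prod_pair hij]
  simp only [if_true, if_neg hij.symm, mul_ite, mul_one, mul_zero, Finset.sum_ite_eq',
    Finset.mem_univ]
  have h3 : ∏ r ∈ ({i, j} : Finset (Fin k))ᶜ, ∑ s', (if r = i then if s' = s then w s' else 0 else
      if r = j then if s' = t then w s' else 0 else w s' * f r s') =
      ∏ r ∈ ({i, j} : Finset (Fin k))ᶜ, ∑ s', w s' * f r s' := by
    refine Finset.prod_congr rfl fun r hr => ?_
    simp only [Finset.mem_compl, Finset.mem_insert, Finset.mem_singleton, not_or] at hr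
    simp only [if_neg hr.1, if_neg hr.2]
  rw [h3]
  ring

theorem mass_iidWeight_pair {w : S → ℝ} (hw1 : ∑ s, w s = 1) {i j : Fin k} (hij : i ≠ j) :
    mass (iidWeight k w) (fun v => (v i, v j)) = pairWeight w := by
  classical
  funext z
  have := sum_iidWeight_pair w (fun _ => 1) (fun s t => if (s, t) = z then 1 else 0) hij rfl rfl
  simp only [Pi.one_apply, Finset.prod_const_one, mul_one, hw1, mul_ite, mul_zero] at this
  rw [mass_eq, this, pairWeight, ← Fintype.sum_prod_type' fun s t => if (s, t) = z then w s * w t else 0]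
  simp

/-- The samples at two positions are independent of the samples at the other positions. -/
theorem ent_iidWeight_pair_prod {w : S → ℝ} (hw : ∀ s, 0 ≤ w s) (hw1 : ∑ s, w s = 1) {i j : Fin k}
    (hij : i ≠ j) (X : S → S → γ) (Y : S → δ) :
    ent (iidWeight k w) (fun v => (X (v i) (v j), fun r : {r // r ≠ i ∧ r ≠ j} => Y (v r))) =
      ent (iidWeight k w) (fun v => X (v i) (v j)) +
        ent (iidWeight k w) (fun v (r : {r // r ≠ i ∧ r ≠ j}) => Y (v r)) := by
  classical
  refine ent_prod_of_indep (iidWeight_nonneg hw) _ _ fun v => ?_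
  set f : Fin k → S → ℝ := fun r s => if r ≠ i ∧ r ≠ j then (if Y s = Y (v r) then 1 else 0) else 1
    with hf
  have hi : f i = 1 := by funext s; simp [hf]
  have hj : f j = 1 := by funext s; simp [hf]
  have hprod : ∀ v' : Fin k → S, ∏ r, f r (v' r) =
      if (fun r : {r // r ≠ i ∧ r ≠ j} => Y (v' r.1)) = (fun r => Y (v r.1)) then 1 else 0 := by
    intro v'
    by_cases h : ∀ r, r ≠ i ∧ r ≠ j → Y (v' r) = Y (v r)
    · rw [if_pos (funext fun r : {r // r ≠ i ∧ r ≠ j} => h r.1 r.2)]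
      refine Finset.prod_eq_one fun r _ => ?_
      by_cases h' : r ≠ i ∧ r ≠ j
      · simp only [hf, if_pos h', if_pos (h r h')]
      · simp only [hf, if_neg h']
    · rw [if_neg fun h' => h fun r hr => congr_fun h' (⟨r, hr⟩ : {r // r ≠ i ∧ r ≠ j})]
      push Not at h
      obtain ⟨r, hr, h⟩ := h
      refine Finset.prod_eq_zero (Finset.mem_univ r) ?_
      simp only [hf, if_pos hr, if_neg h]
  -- `e1` is the joint mass, `e2` the marginal of the pair and `e3` the marginal of the rest.
  have e1 := sum_iidWeight_pair w f (fun s t => if X s t = X (v i) (v j) then 1 else 0) hij hi hj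
  have e2 := sum_iidWeight_pair w (fun _ => 1)
    (fun s t => if X s t = X (v i) (v j) then 1 else 0) hij rfl rfl
  have e3 := sum_iidWeight_pair w f (fun s t => 1) hij hi hj
  simp only [hprod] at e1 e3
  simp only [Pi.one_apply, Finset.prod_const_one, mul_one, hw1, one_mul,
    ← Finset.mul_sum] at e2 e3
  simp only [mass_eq, Prod.mk.injEq]
  have e1' : ∀ v' : Fin k → S, (if X (v' i) (v' j) = X (v i) (v j) ∧
      (fun r : {r // r ≠ i ∧ r ≠ j} => Y (v' r.1)) = (fun r => Y (v r.1)) then iidWeight k w v' else 0) =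
      iidWeight k w v' * ((if X (v' i) (v' j) = X (v i) (v j) then 1 else 0) *
      if (fun r : {r // r ≠ i ∧ r ≠ j} => Y (v' r.1)) = (fun r => Y (v r.1)) then 1 else 0) := by
    intro v'
    rw [ite_and]
    split_ifs <;> simp
  simp only [e1', e1]
  simp only [mul_ite, mul_one, mul_zero] at e2 e3 ⊢
  rw [e2, e3]

end IID

/-! ### Entropy of probability vectors and of their convolutions -/

section Simplex

open Real

variable {F : Type*} [Fintype F]

theorem le_one_of_mem_stdSimplex {p : F → ℝ} (hp : p ∈ stdSimplex ℝ F) (a : F) : p a ≤ 1 :=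
  hp.2 ▸ Finset.single_le_sum (fun a _ => hp.1 a) (Finset.mem_univ a)

theorem shannon_nonneg {p : F → ℝ} (hp : p ∈ stdSimplex ℝ F) : 0 ≤ shannon p :=
  Finset.sum_nonneg fun a _ => negMulLog_nonneg (hp.1 a) (le_one_of_mem_stdSimplex hp a)

/-- The entropy deficit of a probability vector. -/
def deficit (p : F → ℝ) : ℝ := log (Fintype.card F) - shannon p

/-- The squared Euclidean distance to the uniform vector. -/
def distUnif (p : F → ℝ) : ℝ := ∑ a, (p a - (Fintype.card F : ℝ)⁻¹) ^ 2

/-- With `sq_le_klFun`, this makes the entropy deficit comparable to the squared `L²` distance from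
uniform, which behaves well under convolution. -/
theorem klFun_le_sq {t : ℝ} (ht : 0 ≤ t) : InformationTheory.klFun t ≤ (t - 1) ^ 2 := by
  rw [InformationTheory.klFun_apply]
  rcases ht.eq_or_lt with h | h
  · simp [← h]
  nlinarith [log_le_sub_one_of_pos h]

theorem sq_le_klFun {t q : ℝ} (ht : 0 ≤ t) (htq : t ≤ q) (hq : 1 ≤ q) :
    (t - 1) ^ 2 ≤ 4 * q * InformationTheory.klFun t := by
  rw [InformationTheory.klFun_apply]
  -- Comparison through `(√t - 1)²`: it is at most `klFun t`, and `(√t + 1)² ≤ 2t + 2 ≤ 4q`.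
  obtain ⟨s, hs, rfl⟩ : ∃ s, 0 ≤ s ∧ t = s ^ 2 := ⟨√t, sqrt_nonneg t, (sq_sqrt ht).symm⟩
  have h1 : (s - 1) ^ 2 ≤ s ^ 2 * log (s ^ 2) + 1 - s ^ 2 := by
    rcases hs.eq_or_lt with h | h
    · simp [← h]
    have h2 := one_sub_inv_le_log_of_pos h
    have h3 : s ^ 2 * (1 - s⁻¹) = s ^ 2 - s := by field_simp
    rw [log_pow]
    push_cast
    nlinarith [mul_le_mul_of_nonneg_left h2 (sq_nonneg s)]
  have h4 : (s + 1) ^ 2 ≤ 4 * q := by nlinarith [sq_nonneg (s - 1)]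
  calc (s ^ 2 - 1) ^ 2 = (s + 1) ^ 2 * (s - 1) ^ 2 := by ring
    _ ≤ 4 * q * (s ^ 2 * log (s ^ 2) + 1 - s ^ 2) :=
      mul_le_mul h4 h1 (sq_nonneg _) (by positivity)

/-- The deficit is the Kullback–Leibler divergence from the uniform law. -/
theorem deficit_eq [Nonempty F] {p : F → ℝ} (hp : p ∈ stdSimplex ℝ F) :
    deficit p =
      (Fintype.card F : ℝ)⁻¹ * ∑ a, InformationTheory.klFun (Fintype.card F * p a) := by
  have hq : (Fintype.card F : ℝ) ≠ 0 := by simp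
  have h1 : ∀ a, InformationTheory.klFun (Fintype.card F * p a) =
      Fintype.card F * (p a * log (Fintype.card F) - negMulLog (p a) - p a) + 1 := by
    intro a
    rw [InformationTheory.klFun_apply, negMulLog]
    by_cases h : p a = 0
    · simp [h]
    rw [log_mul hq h]
    ring
  simp only [h1, Finset.sum_add_distrib, ← Finset.mul_sum, Finset.sum_sub_distrib,
    ← Finset.sum_mul, hp.2]
  rw [deficit, shannon]
  simp only [one_mul, Finset.sum_const, Finset.card_univ, nsmul_eq_mul, mul_one]
  field_simp
  ring

theorem deficit_nonneg [Nonempty F] {p : F → ℝ} (hp : p ∈ stdSimplex ℝ F) : 0 ≤ deficit p := by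
  rw [deficit_eq hp]
  exact mul_nonneg (by positivity) (Finset.sum_nonneg fun a _ =>
    InformationTheory.klFun_nonneg (mul_nonneg (by positivity) (hp.1 a)))

theorem sum_sq_eq_distUnif [Nonempty F] (p : F → ℝ) :
    ∑ a, (Fintype.card F * p a - 1) ^ 2 = (Fintype.card F : ℝ) ^ 2 * distUnif p := by
  have hq : (Fintype.card F : ℝ) ≠ 0 := by simp
  rw [distUnif, Finset.mul_sum]
  refine Finset.sum_congr rfl fun a _ => ?_
  rw [← mul_pow, mul_sub, mul_inv_cancel₀ hq]

theorem deficit_le [Nonempty F] {p : F → ℝ} (hp : p ∈ stdSimplex ℝ F) :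
    deficit p ≤ Fintype.card F * distUnif p := by
  have hq : (Fintype.card F : ℝ) ≠ 0 := by simp
  rw [deficit_eq hp]
  calc _ ≤ (Fintype.card F : ℝ)⁻¹ * ∑ a, (Fintype.card F * p a - 1) ^ 2 := by
        gcongr with a
        exact klFun_le_sq (mul_nonneg (by positivity) (hp.1 a))
    _ = _ := by rw [sum_sq_eq_distUnif]; field_simp

theorem distUnif_le [Nonempty F] {p : F → ℝ} (hp : p ∈ stdSimplex ℝ F) :
    distUnif p ≤ 4 * deficit p := by
  have hq : (0 : ℝ) < Fintype.card F := by simp [Fintype.card_pos]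
  have hq1 : (1 : ℝ) ≤ Fintype.card F := by exact_mod_cast Fintype.card_pos
  have h1 : (Fintype.card F : ℝ) ^ 2 * distUnif p ≤
      4 * Fintype.card F * ∑ a, InformationTheory.klFun (Fintype.card F * p a) := by
    rw [← sum_sq_eq_distUnif, Finset.mul_sum]
    exact Finset.sum_le_sum fun a _ => sq_le_klFun (mul_nonneg hq.le (hp.1 a))
      (mul_le_of_le_one_right hq.le (le_one_of_mem_stdSimplex hp a)) hq1
  have h2 : ∑ a, InformationTheory.klFun (Fintype.card F * p a) = Fintype.card F * deficit p := by
    rw [deficit_eq hp]; field_simp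
  rw [h2] at h1
  have h3 : (0 : ℝ) < (Fintype.card F : ℝ) ^ 2 := by positivity
  refine le_of_mul_le_mul_left ?_ h3
  linarith

/-- A nearly deterministic vector has error probability much smaller than its entropy. -/
theorem exists_shannon_le_imp_error_le [Nonempty F] {η : ℝ} (hη : 0 < η) :
    ∃ δ > 0, ∀ p ∈ stdSimplex ℝ F, shannon p ≤ δ → ∃ a, 1 - p a ≤ η * shannon p := by
  classical
  -- If the error probability is at most `exp (-η⁻¹)`, every value other than the mode has `-log (p
  -- a) ≥ η⁻¹`, so the entropy is at least `η⁻¹` times the error.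
  refine ⟨exp (-η⁻¹), exp_pos _, fun p hp h => ?_⟩
  obtain ⟨a₀, ha₀⟩ := Finite.exists_max p
  refine ⟨a₀, ?_⟩
  have h0 := shannon_nonneg hp
  have hε : 1 - p a₀ ≤ shannon p := by
    calc 1 - p a₀ = ∑ a, p a * (1 - p a₀) := by rw [← Finset.sum_mul, hp.2, one_mul]
      _ ≤ shannon p := by
        refine Finset.sum_le_sum fun a _ => ?_
        rcases (hp.1 a).eq_or_lt with h1 | h1
        · simp [← h1]
        rw [negMulLog, neg_mul_comm]
        exact mul_le_mul_of_nonneg_left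
          (by linarith [log_le_sub_one_of_pos h1, ha₀ a]) h1.le
  rcases (sub_nonneg.2 (le_one_of_mem_stdSimplex hp a₀)).eq_or_lt with h1 | h1
  · rw [← h1]; positivity
  have hlog : η⁻¹ ≤ -log (1 - p a₀) := by
    have := log_le_log h1 (hε.trans h)
    rw [log_exp] at this
    linarith
  have herr : ∑ a ∈ Finset.univ.erase a₀, p a = 1 - p a₀ := by
    rw [← hp.2, ← Finset.add_sum_erase _ _ (Finset.mem_univ a₀)]; ring
  have : (1 - p a₀) * η⁻¹ ≤ shannon p := by
    calc (1 - p a₀) * η⁻¹ = ∑ a ∈ Finset.univ.erase a₀, p a * η⁻¹ := by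
          rw [← Finset.sum_mul, herr]
      _ ≤ ∑ a ∈ Finset.univ.erase a₀, negMulLog (p a) := by
        refine Finset.sum_le_sum fun a ha => ?_
        rcases (hp.1 a).eq_or_lt with h2 | h2
        · simp [← h2]
        rw [negMulLog, neg_mul_comm]
        refine mul_le_mul_of_nonneg_left (hlog.trans (neg_le_neg (log_le_log h2 ?_))) h2.le
        rw [← herr]
        exact Finset.single_le_sum (fun a _ => hp.1 a) ha
      _ ≤ shannon p := Finset.sum_le_univ_sum_of_nonneg fun a =>
        negMulLog_nonneg (hp.1 a) (le_one_of_mem_stdSimplex hp a)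
  rw [← div_eq_mul_inv, div_le_iff₀ hη] at this
  linarith

theorem mul_log_sub_log_le {r R : ℝ} (hr : 0 ≤ r) (hR : r ≤ R) : r * (log R - log r) ≤ R - r := by
  rcases hr.eq_or_lt with h | h
  · simpa [← h] using hr.trans hR
  have hR0 := h.trans_le hR
  have := log_le_sub_one_of_pos (div_pos hR0 h)
  rw [log_div hR0.ne' h.ne'] at this
  calc _ ≤ r * (R / r - 1) := by gcongr
    _ = _ := by field_simp

/-- For `r` the joint masses at a fixed outcome, this is the contribution of that outcome to a
conditional entropy. It is bounded below in two ways: by the total mass, for unlikely outcomes, and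
by square roots of the non-dominant masses, for the likely one. -/
theorem sum_negMulLog_sub (r : F → ℝ) :
    ∑ b, negMulLog (r b) - negMulLog (∑ b, r b) = ∑ b, r b * (log (∑ b, r b) - log (r b)) := by
  simp only [negMulLog, mul_sub, Finset.sum_sub_distrib, ← Finset.sum_mul, neg_mul,
    Finset.sum_neg_distrib]
  ring

theorem sum_negMulLog_sub_le_card {r : F → ℝ} (hr : ∀ b, 0 ≤ r b) :
    ∑ b, negMulLog (r b) - negMulLog (∑ b, r b) ≤ Fintype.card F * ∑ b, r b := by
  rw [sum_negMulLog_sub]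
  calc _ ≤ ∑ _b : F, ∑ b, r b := Finset.sum_le_sum fun b _ =>
        (mul_log_sub_log_le (hr b)
          (Finset.single_le_sum (fun b _ => hr b) (Finset.mem_univ b))).trans
          (sub_le_self _ (hr b))
    _ = _ := by simp

theorem sum_negMulLog_sub_le_sqrt [DecidableEq F] {r : F → ℝ} (hr : ∀ b, 0 ≤ r b)
    (h1 : ∑ b, r b ≤ 1) (b₀ : F) :
    ∑ b, negMulLog (r b) - negMulLog (∑ b, r b) ≤ 3 * ∑ b ∈ Finset.univ.erase b₀, √(r b) := by
  have hle : ∀ b, r b ≤ ∑ b, r b := fun b =>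
    Finset.single_le_sum (fun b _ => hr b) (Finset.mem_univ b)
  have hsq : ∀ b, r b ≤ √(r b) := fun b => by
    exact (le_abs_self _).trans (abs_le_sqrt (by nlinarith [hr b, (hle b).trans h1]))
  -- The total has nonpositive logarithm, and `-log √r ≤ 1/√r - 1` gives `-r log r ≤ 2 √r`.
  have hlog : ∀ b, r b * (log (∑ b, r b) - log (r b)) ≤ 2 * √(r b) := fun b => by
    have h2 : log (∑ b, r b) ≤ 0 := log_nonpos (Finset.sum_nonneg fun b _ => hr b) h1
    rcases (hr b).eq_or_lt with h | h
    · simp [← h]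
    have h3 := one_sub_inv_le_log_of_pos (sqrt_pos.2 h)
    rw [log_sqrt h.le] at h3
    have h4 : r b * (√(r b))⁻¹ = √(r b) := by
      rw [← div_eq_mul_inv, div_sqrt]
    nlinarith [mul_le_mul_of_nonneg_left h3 h.le, mul_nonpos_of_nonneg_of_nonpos h.le h2]
  rw [sum_negMulLog_sub, ← Finset.add_sum_erase _ _ (Finset.mem_univ b₀)]
  have h3 : r b₀ * (log (∑ b, r b) - log (r b₀)) ≤ ∑ b ∈ Finset.univ.erase b₀, √(r b) := by
    refine (mul_log_sub_log_le (hr b₀) (hle b₀)).trans ?_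
    rw [← Finset.add_sum_erase _ _ (Finset.mem_univ b₀), add_sub_cancel_left]
    exact Finset.sum_le_sum fun b _ => hsq b
  have h4 : ∑ b ∈ Finset.univ.erase b₀, r b * (log (∑ b, r b) - log (r b)) ≤
      2 * ∑ b ∈ Finset.univ.erase b₀, √(r b) := by
    rw [Finset.mul_sum]
    exact Finset.sum_le_sum fun b _ => hlog b
  linarith

theorem continuous_shannon : Continuous (shannon : (F → ℝ) → ℝ) := by
  unfold shannon
  fun_prop

end Simplex

/-! ### Convolutions of two laws on a finite field -/

section Convolution

open Real

variable {F : Type*} [Field F] [Fintype F]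

/-- The law of `a + α b` for independent `a` and `b` with laws `p₁` and `p₂`. -/
def conv (α : F) (p₁ p₂ : F → ℝ) (u : F) : ℝ := ∑ b, p₁ (u - α * b) * p₂ b

theorem sum_comp_sub_mul {α : F} (u : F) (hα : α ≠ 0) (f : F → ℝ) :
    ∑ b, f (u - α * b) = ∑ a, f a :=
  Fintype.sum_equiv ((Equiv.mulLeft₀ α hα).trans (Equiv.subLeft u)) _ _ fun _ => rfl

theorem sum_comp_sub_const (c : F) (f : F → ℝ) : ∑ u, f (u - c) = ∑ a, f a :=
  Fintype.sum_equiv (Equiv.subRight c) _ _ fun _ => rfl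

theorem conv_mem {α : F} {p₁ p₂ : F → ℝ} (h₁ : p₁ ∈ stdSimplex ℝ F) (h₂ : p₂ ∈ stdSimplex ℝ F) :
    conv α p₁ p₂ ∈ stdSimplex ℝ F := by
  refine ⟨fun u => Finset.sum_nonneg fun b _ => mul_nonneg (h₁.1 _) (h₂.1 _), ?_⟩
  unfold conv
  rw [Finset.sum_comm]
  simp only [← Finset.sum_mul, sum_comp_sub_const, h₁.2, one_mul, h₂.2]

theorem conv_eq {α : F} (hα : α ≠ 0) (p₁ p₂ : F → ℝ) (u : F) :
    conv α p₁ p₂ u = ∑ a, p₁ a * p₂ ((u - a) / α) := by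
  rw [conv, ← sum_comp_sub_mul u hα fun a => p₁ a * p₂ ((u - a) / α)]
  refine Finset.sum_congr rfl fun b _ => ?_
  rw [sub_sub_cancel, mul_div_cancel_left₀ _ hα]

/-- The convolution is a `p₂`-mixture of translates of `p₁`, and entropy is concave. -/
theorem shannon_le_shannon_conv_left {α : F} {p₁ p₂ : F → ℝ} (h₁ : p₁ ∈ stdSimplex ℝ F)
    (h₂ : p₂ ∈ stdSimplex ℝ F) : shannon p₁ ≤ shannon (conv α p₁ p₂) := by
  calc shannon p₁ = ∑ b, p₂ b * ∑ u, negMulLog (p₁ (u - α * b)) := by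
        simp only [sum_comp_sub_const _ fun a => negMulLog (p₁ a), ← Finset.sum_mul, h₂.2, one_mul]
        rfl
    _ = ∑ u, ∑ b, p₂ b * negMulLog (p₁ (u - α * b)) := by
        simp only [Finset.mul_sum]; exact Finset.sum_comm
    _ ≤ shannon (conv α p₁ p₂) := by
        refine Finset.sum_le_sum fun u _ => ?_
        have := concaveOn_negMulLog.le_map_sum (t := Finset.univ) (w := p₂)
          (p := fun b => p₁ (u - α * b)) (fun b _ => h₂.1 b) h₂.2 fun b _ => h₁.1 _
        simpa only [smul_eq_mul, conv, mul_comm] using this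

theorem sum_comp_sub_div {α : F} (a : F) (hα : α ≠ 0) (f : F → ℝ) :
    ∑ u, f ((u - a) / α) = ∑ b, f b :=
  Fintype.sum_equiv ((Equiv.subRight a).trans (Equiv.divRight₀ α hα)) _ _ fun _ => rfl

theorem shannon_eq_sum_sum {α : F} (hα : α ≠ 0) {p₁ : F → ℝ} (p₂ : F → ℝ)
    (h₁ : p₁ ∈ stdSimplex ℝ F) :
    shannon p₂ = ∑ u, ∑ a, p₁ a * negMulLog (p₂ ((u - a) / α)) := by
  rw [Finset.sum_comm]
  simp only [← Finset.mul_sum, sum_comp_sub_div _ hα fun b => negMulLog (p₂ b), ← Finset.sum_mul,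
    h₁.2, one_mul]
  rfl

theorem shannon_le_shannon_conv_right {α : F} (hα : α ≠ 0) {p₁ p₂ : F → ℝ}
    (h₁ : p₁ ∈ stdSimplex ℝ F) (h₂ : p₂ ∈ stdSimplex ℝ F) :
    shannon p₂ ≤ shannon (conv α p₁ p₂) := by
  rw [shannon_eq_sum_sum hα p₂ h₁]
  refine Finset.sum_le_sum fun u _ => ?_
  rw [conv_eq hα]
  simpa only [smul_eq_mul] using concaveOn_negMulLog.le_map_sum (t := Finset.univ) (w := p₁)
    (p := fun a => p₂ ((u - a) / α)) (fun a _ => h₁.1 a) h₁.2 fun a _ => h₂.1 _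

/-- The deviation of the convolution from uniform is the convolution of the deviations, since the
cross terms reduce to total masses. Cauchy–Schwarz bounds it at each of the `|F|` points. -/
theorem distUnif_conv_le {α : F} (hα : α ≠ 0) {p₁ p₂ : F → ℝ} (h₁ : p₁ ∈ stdSimplex ℝ F)
    (h₂ : p₂ ∈ stdSimplex ℝ F) :
    distUnif (conv α p₁ p₂) ≤ Fintype.card F * (distUnif p₁ * distUnif p₂) := by
  have hq : (Fintype.card F : ℝ) ≠ 0 := by simp
  set c : ℝ := (Fintype.card F : ℝ)⁻¹ with hc
  have hcq : (Fintype.card F : ℝ) * c = 1 := mul_inv_cancel₀ hq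
  calc distUnif (conv α p₁ p₂) ≤ ∑ _u : F, distUnif p₁ * distUnif p₂ := by
        refine Finset.sum_le_sum fun u _ => ?_
        have h3 : conv α p₁ p₂ u - c = ∑ b, (p₁ (u - α * b) - c) * (p₂ b - c) := by
          simp only [sub_mul, mul_sub, Finset.sum_sub_distrib, ← Finset.mul_sum, ← Finset.sum_mul,
            sum_comp_sub_mul u hα, h₁.2, h₂.2]
          simp only [Finset.sum_const, Finset.card_univ, nsmul_eq_mul, hcq, conv]
          ring
        rw [h3, distUnif, distUnif, ← sum_comp_sub_mul u hα fun a => (p₁ a - c) ^ 2]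
        exact Finset.sum_mul_sq_le_sq_mul_sq _ _ _
    _ = _ := by simp

theorem deficit_conv_le {α : F} (hα : α ≠ 0) {p₁ p₂ : F → ℝ} (h₁ : p₁ ∈ stdSimplex ℝ F)
    (h₂ : p₂ ∈ stdSimplex ℝ F) :
    deficit (conv α p₁ p₂) ≤ 16 * (Fintype.card F : ℝ) ^ 2 * (deficit p₁ * deficit p₂) := by
  have hd : ∀ p : F → ℝ, 0 ≤ distUnif p := fun p => Finset.sum_nonneg fun a _ => sq_nonneg _
  calc deficit (conv α p₁ p₂) ≤ Fintype.card F * distUnif (conv α p₁ p₂) :=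
        deficit_le (conv_mem h₁ h₂)
    _ ≤ Fintype.card F * (Fintype.card F * ((4 * deficit p₁) * (4 * deficit p₂))) := by
        refine mul_le_mul_of_nonneg_left ((distUnif_conv_le hα h₁ h₂).trans ?_) (by positivity)
        exact mul_le_mul_of_nonneg_left (mul_le_mul (distUnif_le h₁) (distUnif_le h₂) (hd _)
          (mul_nonneg (by norm_num) (deficit_nonneg h₁))) (by positivity)
    _ = _ := by ring

/-- The entropy that remains in `(a, b)` when `a + α b` is known is at most proportional to the
probability that one of them is not its most likely value. -/
theorem shannon_add_sub_conv_le {α : F} (hα : α ≠ 0) {p₁ p₂ : F → ℝ} (h₁ : p₁ ∈ stdSimplex ℝ F)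
    (h₂ : p₂ ∈ stdSimplex ℝ F) (a₀ b₀ : F) :
    shannon p₁ + shannon p₂ - shannon (conv α p₁ p₂) ≤
      (Fintype.card F + 2) * ((1 - p₁ a₀) + (1 - p₂ b₀)) := by
  classical
  set u₀ := a₀ + α * b₀ with hu₀
  set r : F → F → ℝ := fun u b => p₁ (u - α * b) * p₂ b with hr
  have hr0 : ∀ u b, 0 ≤ r u b := fun u b => mul_nonneg (h₁.1 _) (h₂.1 _)
  have hc := conv_mem (α := α) h₁ h₂
  -- The entropy lost is `H(b | a + α b)`, split over the values `u` of the sum.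
  have e1 : shannon p₁ + shannon p₂ - shannon (conv α p₁ p₂) =
      ∑ u, (∑ b, negMulLog (r u b) - negMulLog (∑ b, r u b)) := by
    rw [Finset.sum_sub_distrib]
    congr 1
    rw [Finset.sum_comm]
    simp only [hr, negMulLog_mul, Finset.sum_add_distrib, ← Finset.mul_sum, ← Finset.sum_mul,
      sum_comp_sub_const _ fun a => negMulLog (p₁ a), sum_comp_sub_const _ p₁, h₁.2, h₂.2]
    simp [shannon]
  have herr₁ : ∑ a ∈ Finset.univ.erase a₀, p₁ a = 1 - p₁ a₀ := by
    rw [← h₁.2, ← Finset.add_sum_erase _ _ (Finset.mem_univ a₀)]; ring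
  have herr₂ : ∑ a ∈ Finset.univ.erase b₀, p₂ a = 1 - p₂ b₀ := by
    rw [← h₂.2, ← Finset.add_sum_erase _ _ (Finset.mem_univ b₀)]; ring
  have herr : ∑ u ∈ Finset.univ.erase u₀, ∑ b, r u b ≤ (1 - p₁ a₀) + (1 - p₂ b₀) := by
    have h3 : ∑ u ∈ Finset.univ.erase u₀, ∑ b, r u b = 1 - conv α p₁ p₂ u₀ := by
      rw [← hc.2, ← Finset.add_sum_erase _ _ (Finset.mem_univ u₀)]
      simp [conv, hr]
    have h4 : p₁ a₀ * p₂ b₀ ≤ conv α p₁ p₂ u₀ := by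
      have := Finset.single_le_sum (f := r u₀) (fun b _ => hr0 u₀ b) (Finset.mem_univ b₀)
      simpa [hr, hu₀, conv] using this
    rw [h3]
    nlinarith [le_one_of_mem_stdSimplex h₁ a₀, le_one_of_mem_stdSimplex h₂ b₀]
  -- At `u = u₀` and `b ≠ b₀` both values are wrong, so AM-GM bounds the square root of the product
  -- linearly. With the factor `3` this costs `3/2 ≤ 2` times the error; the other `u` cost `|F|`
  -- times it.
  have hsqrt : ∑ b ∈ Finset.univ.erase b₀, √(r u₀ b) ≤ ((1 - p₁ a₀) + (1 - p₂ b₀)) / 2 := by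
    have h3 : ∑ b ∈ Finset.univ.erase b₀, p₁ (u₀ - α * b) = 1 - p₁ a₀ := by
      rw [← h₁.2, ← sum_comp_sub_mul u₀ hα, ← Finset.add_sum_erase _ _ (Finset.mem_univ b₀)]
      simp [hu₀]
    rw [← herr₂, ← h3, ← Finset.sum_add_distrib, Finset.sum_div]
    refine Finset.sum_le_sum fun b _ => ?_
    rw [sqrt_le_left (by have := h₁.1 (u₀ - α * b); have := h₂.1 b; positivity)]
    nlinarith [sq_nonneg (p₁ (u₀ - α * b) - p₂ b)]
  rw [e1, ← Finset.add_sum_erase _ _ (Finset.mem_univ u₀)]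
  have h5 := sum_negMulLog_sub_le_sqrt (hr0 u₀) (le_one_of_mem_stdSimplex hc u₀) b₀
  have h6 : ∑ u ∈ Finset.univ.erase u₀, (∑ b, negMulLog (r u b) - negMulLog (∑ b, r u b)) ≤
      Fintype.card F * ∑ u ∈ Finset.univ.erase u₀, ∑ b, r u b := by
    rw [Finset.mul_sum]
    exact Finset.sum_le_sum fun u _ => sum_negMulLog_sub_le_card (hr0 u)
  have h7 := mul_le_mul_of_nonneg_left herr (Nat.cast_nonneg (α := ℝ) (Fintype.card F))
  have h8 := le_one_of_mem_stdSimplex h₁ a₀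
  have h9 := le_one_of_mem_stdSimplex h₂ b₀
  linarith

/-- When both entropies are at most `δ`, the error bound applies. When one exceeds `δ`, the loss is
at most the other, hence at most the product over `δ`. Averaged over independent side information,
the product term is quadratic. -/
theorem exists_shannon_add_sub_conv_le {α : F} (hα : α ≠ 0) {η : ℝ} (hη : 0 < η) :
    ∃ δ > 0, ∀ p₁ ∈ stdSimplex ℝ F, ∀ p₂ ∈ stdSimplex ℝ F,
      shannon p₁ + shannon p₂ - shannon (conv α p₁ p₂) ≤
        η * (shannon p₁ + shannon p₂) + shannon p₁ * shannon p₂ / δ := by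
  have hq : (0 : ℝ) < Fintype.card F + 2 := by positivity
  obtain ⟨δ, hδ, h⟩ := exists_shannon_le_imp_error_le (F := F) (div_pos hη hq)
  refine ⟨δ, hδ, fun p₁ h₁ p₂ h₂ => ?_⟩
  have n₁ := shannon_nonneg h₁
  have n₂ := shannon_nonneg h₂
  have l₁ := shannon_le_shannon_conv_left (α := α) h₁ h₂
  have l₂ := shannon_le_shannon_conv_right hα h₁ h₂
  by_cases c₁ : shannon p₁ ≤ δ
  · by_cases c₂ : shannon p₂ ≤ δ
    · obtain ⟨a, ha⟩ := h p₁ h₁ c₁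
      obtain ⟨b, hb⟩ := h p₂ h₂ c₂
      have h3 := shannon_add_sub_conv_le hα h₁ h₂ a b
      have h4 := mul_le_mul_of_nonneg_left (add_le_add ha hb) hq.le
      have h5 : ((Fintype.card F : ℝ) + 2) * (η / (Fintype.card F + 2) * shannon p₁ +
          η / (Fintype.card F + 2) * shannon p₂) = η * (shannon p₁ + shannon p₂) := by
        field_simp
      have : 0 ≤ shannon p₁ * shannon p₂ / δ := by positivity
      linarith
    · have : shannon p₁ ≤ shannon p₁ * shannon p₂ / δ := by
        rw [le_div_iff₀ hδ]; exact mul_le_mul_of_nonneg_left (not_le.1 c₂).le n₁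
      have : 0 ≤ η * (shannon p₁ + shannon p₂) := by positivity
      linarith
  · have : shannon p₂ ≤ shannon p₁ * shannon p₂ / δ := by
      rw [le_div_iff₀ hδ, mul_comm]; exact mul_le_mul_of_nonneg_right (not_le.1 c₁).le n₂
    have : 0 ≤ η * (shannon p₁ + shannon p₂) := by positivity
    linarith

theorem continuous_conv (α : F) : Continuous fun p : (F → ℝ) × (F → ℝ) => conv α p.1 p.2 := by
  unfold conv
  fun_prop

end Convolution

/-! ### Strict entropy gain over a prime field -/

section PrimeField

open Real

variable {q : ℕ} [Fact q.Prime]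

/-- A nonzero period generates `ℤ/q` because `q` is prime, so the law is constant. -/
theorem deficit_eq_zero_of_periodic {p : ZMod q → ℝ} (hp : p ∈ stdSimplex ℝ (ZMod q)) {c : ZMod q}
    (hc : c ≠ 0) (h : ∀ x, p (x + c) = p x) : deficit p = 0 := by
  have h1 : ∀ (n : ℕ) x, p (x + n * c) = p x := by
    intro n
    induction n with
    | zero => simp
    | succ n ih => intro x; rw [← ih x, ← h (x + n * c)]; push_cast; ring_nf
  have h2 : ∀ x, p x = p 0 := fun x => by
    have := h1 (x / c).val 0
    rwa [ZMod.natCast_zmod_val, div_mul_cancel₀ _ hc, zero_add] at this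
  have hq : (Fintype.card (ZMod q) : ℝ) ≠ 0 := Nat.cast_ne_zero.2 Fintype.card_ne_zero
  have h3 : Fintype.card (ZMod q) * p 0 = 1 := by
    have := hp.2
    simpa only [h2, Finset.sum_const, Finset.card_univ, nsmul_eq_mul] using this
  rw [deficit_eq hp]
  simp only [h2, h3, InformationTheory.klFun_one, Finset.sum_const_zero, mul_zero]

/-- Two atoms `a ≠ a'` of `p₁` mix distinct translates of `p₂`: if they agreed, `p₂` would have the
period `(a - a') / α`. Jensen is then strict at some point. -/
theorem shannon_lt_shannon_conv {α : ZMod q} (hα : α ≠ 0) {p₁ p₂ : ZMod q → ℝ}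
    (h₁ : p₁ ∈ stdSimplex ℝ (ZMod q)) (h₂ : p₂ ∈ stdSimplex ℝ (ZMod q)) (hs : 0 < shannon p₁)
    (hd : 0 < deficit p₂) : shannon p₂ < shannon (conv α p₁ p₂) := by
  obtain ⟨a, a', haa, ha, ha'⟩ : ∃ a a', a ≠ a' ∧ p₁ a ≠ 0 ∧ p₁ a' ≠ 0 := by
    by_contra! hcon
    obtain ⟨a, ha⟩ : ∃ a, p₁ a ≠ 0 := by
      by_contra! h0
      have := h₁.2
      simp [h0] at this
    have h3 : ∀ b, b ≠ a → p₁ b = 0 := fun b hb => hcon a b hb.symm ha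
    have h4 : p₁ a = 1 := by
      rw [← h₁.2, Finset.sum_eq_single a (fun b _ => h3 b) (by simp)]
    refine hs.ne' (Finset.sum_eq_zero fun b _ => ?_)
    by_cases hb : b = a
    · simp [hb, h4]
    · simp [h3 b hb]
  obtain ⟨x, hx⟩ : ∃ x, p₂ (x + (a - a') / α) ≠ p₂ x := by
    by_contra! hcon
    exact hd.ne' (deficit_eq_zero_of_periodic h₂ (div_ne_zero (sub_ne_zero.2 haa) hα) hcon)
  rw [shannon_eq_sum_sum hα p₂ h₁]
  have jensen := fun u => concaveOn_negMulLog.le_map_sum (t := Finset.univ) (w := p₁)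
    (p := fun a => p₂ ((u - a) / α)) (fun a _ => h₁.1 a) h₁.2 fun a _ => h₂.1 _
  have strict := (strictConcaveOn_negMulLog.lt_map_sum_iff_of_nonneg (t := Finset.univ) (w := p₁)
    (p := fun b => p₂ ((α * x + a - b) / α)) (fun a _ => h₁.1 a) h₁.2 fun a _ => h₂.1 _).2
    ⟨a', Finset.mem_univ _, a, Finset.mem_univ _, ha', ha, by
      have e1 : (α * x + a - a') / α = x + (a - a') / α := by field_simp; ring
      have e2 : (α * x + a - a) / α = x := by field_simp; ring
      simpa only [e1, e2] using hx⟩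
  simp only [smul_eq_mul] at jensen strict
  refine Finset.sum_lt_sum (fun u _ => ?_) ⟨α * x + a, Finset.mem_univ _, ?_⟩
  · rw [conv_eq hα]; exact jensen u
  · rw [conv_eq hα]; exact strict

/-- The strict gain is continuous and positive on a compact set of pairs of laws. -/
theorem exists_shannon_add_le_shannon_conv {α : ZMod q} (hα : α ≠ 0) {τ : ℝ} (hτ : 0 < τ) :
    ∃ ε > 0, ∀ p₁ ∈ stdSimplex ℝ (ZMod q), ∀ p₂ ∈ stdSimplex ℝ (ZMod q), τ ≤ shannon p₁ →
      τ ≤ deficit p₂ → shannon p₂ + ε ≤ shannon (conv α p₁ p₂) := by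
  set K : Set ((ZMod q → ℝ) × (ZMod q → ℝ)) :=
    (stdSimplex ℝ (ZMod q) ×ˢ stdSimplex ℝ (ZMod q)) ∩ {p | τ ≤ shannon p.1 ∧ τ ≤ deficit p.2}
    with hK
  have hcs := continuous_shannon (F := ZMod q)
  have hcompact : IsCompact K := by
    refine ((isCompact_stdSimplex ℝ _).prod (isCompact_stdSimplex ℝ _)).inter_right ?_
    have hcd : Continuous fun p : (ZMod q → ℝ) × (ZMod q → ℝ) => deficit p.2 :=
      continuous_const.sub (hcs.comp continuous_snd)
    exact (isClosed_le continuous_const (hcs.comp continuous_fst)).inter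
      (isClosed_le continuous_const hcd)
  rcases K.eq_empty_or_nonempty with hne | hne
  · refine ⟨1, one_pos, fun p₁ h₁ p₂ h₂ hs hd => ?_⟩
    have : (p₁, p₂) ∈ K := ⟨⟨h₁, h₂⟩, hs, hd⟩
    simp [hne] at this
  obtain ⟨m, hm, hmin⟩ := hcompact.exists_isMinOn hne
    (f := fun p => shannon (conv α p.1 p.2) - shannon p.2)
    ((hcs.comp (continuous_conv α)).sub (hcs.comp continuous_snd)).continuousOn
  refine ⟨shannon (conv α m.1 m.2) - shannon m.2, sub_pos.2 (shannon_lt_shannon_conv hα hm.1.1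
    hm.1.2 (hτ.trans_le hm.2.1) (hτ.trans_le hm.2.2)), fun p₁ h₁ p₂ h₂ hs hd => ?_⟩
  have := hmin (show (p₁, p₂) ∈ K from ⟨⟨h₁, h₂⟩, hs, hd⟩)
  simp only [Set.mem_ofPred_eq] at this
  linarith

end PrimeField

/-! ### Averages over the side information -/

section Average

open Real

variable {ι : Type*} [Fintype ι] {q : ℕ} [Fact q.Prime] {P : ι → ℝ}
  {p : ι → ZMod q → ℝ}

theorem sum_sum_mul_left (hP : ∑ y, P y = 1) (f : ι → ℝ) :
    ∑ x, ∑ y, P x * P y * f x = ∑ x, P x * f x := by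
  refine Finset.sum_congr rfl fun x _ => ?_
  rw [← Finset.sum_mul, ← Finset.mul_sum, hP, mul_one]

theorem sum_sum_mul_right (hP : ∑ y, P y = 1) (f : ι → ℝ) :
    ∑ x, ∑ y, P x * P y * f y = ∑ x, P x * f x := by
  rw [Finset.sum_comm, ← sum_sum_mul_left hP f]
  simp only [mul_comm]

theorem sum_sum_mul_mul (f g : ι → ℝ) :
    ∑ x, ∑ y, P x * P y * (f x * g y) = (∑ x, P x * f x) * ∑ y, P y * g y := by
  rw [Finset.sum_mul_sum]
  refine Finset.sum_congr rfl fun x _ => Finset.sum_congr rfl fun y _ => by ring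

theorem sum_sum_mul_le (hP0 : ∀ y, 0 ≤ P y) {f g : ι → ι → ℝ} (h : ∀ x y, f x y ≤ g x y) :
    ∑ x, ∑ y, P x * P y * f x y ≤ ∑ x, ∑ y, P x * P y * g x y :=
  Finset.sum_le_sum fun x _ => Finset.sum_le_sum fun y _ =>
    mul_le_mul_of_nonneg_left (h x y) (mul_nonneg (hP0 x) (hP0 y))

theorem sum_mul_deficit (hP : ∑ y, P y = 1) :
    ∑ y, P y * deficit (p y) = log q - ∑ y, P y * shannon (p y) := by
  simp only [deficit, mul_sub, Finset.sum_sub_distrib, ← Finset.sum_mul, hP, one_mul, ZMod.card]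

theorem log_prime_pos : 0 < log q :=
  log_pos (by exact_mod_cast (Fact.out : q.Prime).one_lt)

/-- Every single conditional law may be nearly deterministic or nearly uniform. Still, independence
of the two samples pairs an `x` of sizeable entropy with a `y` of sizeable deficit on a sizeable
part of the mass. -/
theorem exists_average_add_le {α : ZMod q} (hα : α ≠ 0) {τ : ℝ} (hτ : 0 < τ) :
    ∃ ε > 0, ∀ {ι : Type*} [Fintype ι] {P : ι → ℝ} {p : ι → ZMod q → ℝ}, (∀ y, 0 ≤ P y) →
      ∑ y, P y = 1 → (∀ y, p y ∈ stdSimplex ℝ (ZMod q)) → τ ≤ ∑ y, P y * shannon (p y) →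
      ∑ y, P y * shannon (p y) ≤ log q - τ →
      ∑ y, P y * shannon (p y) + ε ≤ ∑ x, ∑ y, P x * P y * shannon (conv α (p x) (p y)) := by
  obtain ⟨ε, hε, h⟩ := exists_shannon_add_le_shannon_conv hα (half_pos hτ)
  have hL : 0 < log q := log_prime_pos
  refine ⟨ε / log q ^ 2 * (τ / 2 * (τ / 2)), by positivity, ?_⟩
  intro ι _ P p hP0 hP hp h1 h2
  -- The truncations `f`, `g` replace indicators: both are at most `log q`, both have mean at least
  -- `τ / 2`, and `f x * g y` vanishes unless the fixed gain `ε` is available.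
  set f : ι → ℝ := fun y => max (shannon (p y) - τ / 2) 0 with hf
  set g : ι → ℝ := fun y => max (deficit (p y) - τ / 2) 0 with hg
  have hs : ∀ y, shannon (p y) ≤ log q := fun y => by
    have := deficit_nonneg (hp y)
    rw [deficit, ZMod.card] at this
    linarith
  have hd : ∀ y, deficit (p y) ≤ log q := fun y => by
    rw [deficit, ZMod.card]
    linarith [shannon_nonneg (hp y)]
  have hpt : ∀ x y, shannon (p y) + ε / log q ^ 2 * (f x * g y) ≤
      shannon (conv α (p x) (p y)) := by
    intro x y
    have h3 := shannon_le_shannon_conv_right hα (hp x) (hp y)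
    by_cases c1 : τ / 2 ≤ shannon (p x)
    · by_cases c2 : τ / 2 ≤ deficit (p y)
      · refine le_trans (add_le_add_right ?_ _) (h _ (hp x) _ (hp y) c1 c2)
        have h4 : f x * g y ≤ log q * log q :=
          mul_le_mul (max_le (by linarith [hs x]) hL.le) (max_le (by linarith [hd y]) hL.le)
            (le_max_right _ _) hL.le
        rw [div_mul_eq_mul_div, div_le_iff₀ (by positivity), sq]
        exact mul_le_mul_of_nonneg_left h4 hε.le
      · have : g y = 0 := max_eq_right (by linarith)
        simpa [this] using h3
    · have : f x = 0 := max_eq_right (by linarith)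
      simpa [this] using h3
  have hsum := sum_sum_mul_le hP0 hpt
  simp only [mul_add, Finset.sum_add_distrib] at hsum
  rw [sum_sum_mul_right hP fun y => shannon (p y)] at hsum
  have hfg : ∑ x, ∑ y, P x * P y * (ε / log q ^ 2 * (f x * g y)) =
      ε / log q ^ 2 * ((∑ x, P x * f x) * ∑ y, P y * g y) := by
    rw [← sum_sum_mul_mul]
    simp only [Finset.mul_sum]
    refine Finset.sum_congr rfl fun x _ => Finset.sum_congr rfl fun y _ => by ring
  rw [hfg] at hsum
  have hlow : ∀ e : ι → ℝ, τ ≤ ∑ y, P y * e y → τ / 2 ≤ ∑ y, P y * max (e y - τ / 2) 0 := by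
    intro e he
    calc τ / 2 ≤ ∑ y, P y * (e y - τ / 2) := by
          simp only [mul_sub, Finset.sum_sub_distrib, ← Finset.sum_mul, hP]; linarith
      _ ≤ _ := Finset.sum_le_sum fun y _ => mul_le_mul_of_nonneg_left (le_max_left _ _) (hP0 y)
  have hf1 := hlow _ h1
  have hg1 := hlow (fun y => deficit (p y)) (by rw [sum_mul_deficit hP]; linarith)
  refine le_trans (add_le_add_right ?_ _) hsum
  exact mul_le_mul_of_nonneg_left (mul_le_mul hf1 hg1 (by positivity) (by linarith)) (by positivity)

/-- By independence, the product bound on deficits averages to the square of the mean deficit. -/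
theorem sub_average_conv_le {α : ZMod q} (hα : α ≠ 0) (hP0 : ∀ y, 0 ≤ P y) (hP : ∑ y, P y = 1)
    (hp : ∀ y, p y ∈ stdSimplex ℝ (ZMod q)) :
    log q - ∑ x, ∑ y, P x * P y * shannon (conv α (p x) (p y)) ≤
      16 * q ^ 2 * (log q - ∑ y, P y * shannon (p y)) ^ 2 := by
  have h1 := sum_sum_mul_le hP0 fun x y => deficit_conv_le hα (hp x) (hp y)
  simp only [mul_left_comm (_ * _ : ℝ) (16 * _ : ℝ) _, ← Finset.mul_sum, ZMod.card] at h1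
  rw [sum_sum_mul_mul (fun x => deficit (p x)) fun x => deficit (p x), sum_mul_deficit hP,
    ← sq] at h1
  refine le_trans (le_of_eq ?_) h1
  have h2 : ∑ x, ∑ y, P x * P y * log q = log q := by
    rw [sum_sum_mul_left hP fun _ => log q, ← Finset.sum_mul, hP, one_mul]
  simp only [deficit, mul_sub, Finset.sum_sub_distrib, ZMod.card, h2]

theorem exists_two_mul_average_sub_le {α : ZMod q} (hα : α ≠ 0) {η : ℝ} (hη : 0 < η) :
    ∃ δ > 0, ∀ {ι : Type*} [Fintype ι] {P : ι → ℝ} {p : ι → ZMod q → ℝ}, (∀ y, 0 ≤ P y) →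
      ∑ y, P y = 1 → (∀ y, p y ∈ stdSimplex ℝ (ZMod q)) → ∑ y, P y * shannon (p y) ≤ δ →
      2 * ∑ y, P y * shannon (p y) - ∑ x, ∑ y, P x * P y * shannon (conv α (p x) (p y)) ≤
        η * ∑ y, P y * shannon (p y) := by
  obtain ⟨δ, hδ, h⟩ := exists_shannon_add_sub_conv_le hα (half_pos (half_pos hη))
  -- The linear terms average to `η / 2 * H`; the product term averages to `H² / δ`, at most `η / 2
  -- * H` for `H ≤ δ * (η / 2)`.
  refine ⟨δ * (η / 2), by positivity, ?_⟩
  intro ι _ P p hP0 hP hp h1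
  set H := ∑ y, P y * shannon (p y) with hH
  have hH0 : 0 ≤ H := Finset.sum_nonneg fun y _ => mul_nonneg (hP0 y) (shannon_nonneg (hp y))
  have h2 := sum_sum_mul_le hP0 fun x y => h _ (hp x) _ (hp y)
  have h3 : ∑ x, ∑ y, P x * P y * (η / 2 / 2 * (shannon (p x) + shannon (p y)) +
      shannon (p x) * shannon (p y) / δ) = η / 2 * H + H * H / δ := by
    have e : ∀ x y, P x * P y * (η / 2 / 2 * (shannon (p x) + shannon (p y)) +
      shannon (p x) * shannon (p y) / δ) = η / 2 / 2 * (P x * P y * shannon (p x)) +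
      η / 2 / 2 * (P x * P y * shannon (p y)) +
      (P x * P y * (shannon (p x) * shannon (p y))) / δ := fun x y => by ring
    simp only [e, Finset.sum_add_distrib, ← Finset.mul_sum, ← Finset.sum_div]
    rw [sum_sum_mul_left hP fun x => shannon (p x), sum_sum_mul_right hP fun x => shannon (p x),
      sum_sum_mul_mul (fun x => shannon (p x)) fun x => shannon (p x)]
    ring
  rw [h3] at h2
  simp only [mul_sub, mul_add, Finset.sum_add_distrib, Finset.sum_sub_distrib] at h2
  rw [sum_sum_mul_left hP fun x => shannon (p x),
    sum_sum_mul_right hP fun x => shannon (p x)] at h2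
  have h4 : H * H / δ ≤ η / 2 * H := by
    rw [div_le_iff₀ hδ]
    calc H * H ≤ δ * (η / 2) * H := by gcongr
      _ = _ := by ring
  linarith

end Average

/-! ### Two samples -/

section Pair

open Real

variable {S 𝒲 γ : Type*} [Fintype S] [Fintype 𝒲]

theorem mass_pairWeight (w : S → ℝ) (X : S → γ) (z : γ × γ) :
    mass (pairWeight w) (fun t => (X t.1, X t.2)) z = mass w X z.1 * mass w X z.2 := by
  classical
  simp only [mass_eq, Fintype.sum_prod_type, Finset.sum_mul_sum, pairWeight, Prod.ext_iff]
  refine Finset.sum_congr rfl fun s _ => Finset.sum_congr rfl fun t _ => ?_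
  split_ifs <;> simp_all

/-- The conditional entropy of `A + α A'` for two independent samples `(A, W)`, `(A', W')`, given
`(W, W')`. -/
def pairEnt {F : Type*} [Field F] (w : S → ℝ) (A : S → F) (W : S → 𝒲) (α : F) : ℝ :=
  cent (pairWeight w) (fun z => A z.1 + α * A z.2) (fun z => (W z.1, W z.2))

/-- Given `(W, W')`, the symbols `A` and `A'` remain independent, so `A + α A'` has the convolved
law. -/
theorem pairEnt_eq {F : Type*} [Field F] [Fintype F] {w : S → ℝ} {A : S → F} {W : S → 𝒲}
    {p : 𝒲 → F → ℝ} (hp : ∀ y, p y ∈ stdSimplex ℝ F)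
    (h : ∀ x y, mass w (fun s => (A s, W s)) (x, y) = mass w W y * p y x) (α : F) :
    pairEnt w A W α = ∑ x, ∑ y, mass w W x * mass w W y * shannon (conv α (p x) (p y)) := by
  classical
  unfold pairEnt
  rw [cent_eq_sum_shannon _ _ _ (fun y : 𝒲 × 𝒲 => conv α (p y.1) (p y.2))
    fun y => (conv_mem (hp _) (hp _)).2, Fintype.sum_prod_type]
  · simp only [mass_pairWeight]
  rintro u ⟨y₁, y₂⟩
  have e := mass_comp (pairWeight w) (fun t => ((A t.1, W t.1), (A t.2, W t.2)))
    fun c => (c.1.1 + α * c.2.1, (c.1.2, c.2.2))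
  refine (congr_fun e (u, (y₁, y₂))).trans ?_
  rw [mass_eq, mass_pairWeight]
  simp only [mass_pairWeight w fun s => (A s, W s)]
  simp only [Fintype.sum_prod_type, Prod.mk.injEq, h]
  have e' : ∀ a b y y', (if a + α * b = u ∧ y = y₁ ∧ y' = y₂ then
      mass w W y * p y a * (mass w W y' * p y' b) else 0) = if y' = y₂ then if y = y₁ then
        if a = u - α * b then mass w W y * p y a * (mass w W y' * p y' b) else 0 else 0 else 0 := by
    intro a b y y'
    rw [eq_sub_iff_add_eq]
    split_ifs <;> simp_all
  simp only [e', Finset.sum_ite_eq', Finset.mem_univ, if_true]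
  rw [Finset.sum_congr rfl fun a _ => Finset.sum_comm, Finset.sum_comm]
  simp only [Finset.sum_ite_eq', Finset.mem_univ, if_true]
  rw [conv, Finset.mul_sum]
  exact Finset.sum_congr rfl fun b _ => by ring

variable {q : ℕ} [Fact q.Prime] {w : S → ℝ}

theorem cent_mem_Icc (hw : ∀ s, 0 ≤ w s) (hw1 : ∑ s, w s = 1) (A : S → ZMod q) (W : S → 𝒲) :
    cent w A W ∈ Set.Icc 0 (log q) := by
  obtain ⟨p, hp, h⟩ := exists_kernel hw A W
  rw [cent_eq_sum_shannon w A W p (fun y => (hp y).2) h]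
  have hP0 := mass_nonneg hw W
  have hP := (sum_mass w W).trans hw1
  have h1 : 0 ≤ ∑ y, mass w W y * deficit (p y) :=
    Finset.sum_nonneg fun y _ => mul_nonneg (hP0 y) (deficit_nonneg (hp y))
  rw [sum_mul_deficit hP] at h1
  exact ⟨Finset.sum_nonneg fun y _ => mul_nonneg (hP0 y) (shannon_nonneg (hp y)), sub_nonneg.1 h1⟩

theorem sub_pairEnt_le {α : ZMod q} (hα : α ≠ 0) (hw : ∀ s, 0 ≤ w s) (hw1 : ∑ s, w s = 1)
    (A : S → ZMod q) (W : S → 𝒲) :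
    log q - pairEnt w A W α ≤ 16 * q ^ 2 * (log q - cent w A W) ^ 2 := by
  obtain ⟨p, hp, h⟩ := exists_kernel hw A W
  rw [cent_eq_sum_shannon w A W p (fun y => (hp y).2) h, pairEnt_eq hp h]
  exact sub_average_conv_le hα (mass_nonneg hw W) ((sum_mass w W).trans hw1) hp

theorem exists_cent_add_le_pairEnt {α : ZMod q} (hα : α ≠ 0) {τ : ℝ} (hτ : 0 < τ) :
    ∃ ε > 0, ∀ {S 𝒲 : Type*} [Fintype S] [Fintype 𝒲] {w : S → ℝ}, (∀ s, 0 ≤ w s) →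
      ∑ s, w s = 1 → ∀ (A : S → ZMod q) (W : S → 𝒲), τ ≤ cent w A W →
      cent w A W ≤ log q - τ → cent w A W + ε ≤ pairEnt w A W α := by
  obtain ⟨ε, hε, H⟩ := exists_average_add_le hα hτ
  refine ⟨ε, hε, ?_⟩
  intro S 𝒲 _ _ w hw hw1 A W
  obtain ⟨p, hp, h⟩ := exists_kernel hw A W
  rw [cent_eq_sum_shannon w A W p (fun y => (hp y).2) h, pairEnt_eq hp h]
  exact H (mass_nonneg hw W) ((sum_mass w W).trans hw1) hp

theorem exists_two_mul_cent_sub_pairEnt_le {α : ZMod q} (hα : α ≠ 0) {η : ℝ} (hη : 0 < η) :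
    ∃ δ > 0, ∀ {S 𝒲 : Type*} [Fintype S] [Fintype 𝒲] {w : S → ℝ}, (∀ s, 0 ≤ w s) →
      ∑ s, w s = 1 → ∀ (A : S → ZMod q) (W : S → 𝒲), cent w A W ≤ δ →
      2 * cent w A W - pairEnt w A W α ≤ η * cent w A W := by
  obtain ⟨δ, hδ, H⟩ := exists_two_mul_average_sub_le hα hη
  refine ⟨δ, hδ, ?_⟩
  intro S 𝒲 _ _ w hw hw1 A W
  obtain ⟨p, hp, h⟩ := exists_kernel hw A W
  rw [cent_eq_sum_shannon w A W p (fun y => (hp y).2) h, pairEnt_eq hp h]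
  exact H (mass_nonneg hw W) ((sum_mass w W).trans hw1) hp

end Pair

/-! ### One step of the transform -/

section Mixing

variable {F : Type*} [Field F] {k : ℕ} {M : Matrix (Fin k) (Fin k) F}

/-- In a mixing matrix the first nonzero entries of two rows are in the same column. -/
theorem IsMixing.exists_rows (hM : IsMixing M) :
    ∃ i j s, i ≠ j ∧ M i s ≠ 0 ∧ M j s ≠ 0 ∧ ∀ s' < s, M i s' = 0 ∧ M j s' = 0 := by
  classical
  have hrow : ∀ i, ∃ s, M i s ≠ 0 ∧ ∀ s' < s, M i s' = 0 := by
    intro i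
    have hne : ∃ s, M i s ≠ 0 := by
      by_contra! h
      exact ((Matrix.isUnit_iff_isUnit_det M).1 hM.1).ne_zero (Matrix.det_eq_zero_of_row_eq_zero i h)
    obtain ⟨s, hs, hmin⟩ := WellFounded.has_min (wellFounded_lt (α := Fin k)) {s | M i s ≠ 0} hne
    exact ⟨s, hs, fun s' h => by_contra fun h' => hmin s' h' h⟩
  choose f hf hf' using hrow
  -- Distinct leading columns would define a permutation of the rows making `M` upper triangular.
  by_cases hinj : Function.Injective f
  · obtain ⟨i, j, hlt, hne⟩ := hM.2 (Equiv.ofBijective f (Finite.injective_iff_bijective.1 hinj))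
    exact absurd (hf' i j hlt) hne
  · simp only [Function.Injective, not_forall] at hinj
    obtain ⟨i, j, hij, hne⟩ := hinj
    exact ⟨i, j, f i, hne, hf i, hij ▸ hf j, fun s' h => ⟨hf' i s' h, hf' j s' (hij ▸ h)⟩⟩

/-- In the inverse of a mixing matrix the last nonzero entries of two columns are in the same
row. -/
theorem IsMixing.exists_columns_inv (hM : IsMixing M) :
    ∃ i j s, i ≠ j ∧ M⁻¹ s i ≠ 0 ∧ M⁻¹ s j ≠ 0 ∧ ∀ s' > s, M⁻¹ s' i = 0 ∧ M⁻¹ s' j = 0 := by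
  classical
  have hdet : IsUnit M.det := (Matrix.isUnit_iff_isUnit_det M).1 hM.1
  have hcol : ∀ i, ∃ s, M⁻¹ s i ≠ 0 ∧ ∀ s' > s, M⁻¹ s' i = 0 := by
    intro i
    have hne : ∃ s, M⁻¹ s i ≠ 0 := by
      by_contra! h
      exact (Matrix.isUnit_nonsing_inv_det M hdet).ne_zero
        (Matrix.det_eq_zero_of_column_eq_zero i h)
    obtain ⟨s, hs, hmin⟩ := WellFounded.has_min (wellFounded_gt (α := Fin k)) {s | M⁻¹ s i ≠ 0} hne
    exact ⟨s, hs, fun s' h => by_contra fun h' => hmin s' h' h⟩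
  choose f hf hf' using hcol
  by_cases hinj : Function.Injective f
  · exfalso
    set π := Equiv.ofBijective f (Finite.injective_iff_bijective.1 hinj) with hπ
    -- Distinct last rows make a column permutation of `M⁻¹` upper triangular. Its inverse is a row
    -- permutation of `M`, again upper triangular, against mixing.
    have htri : Matrix.BlockTriangular (M⁻¹.submatrix id π.symm) id := by
      intro a b hba
      refine hf' _ _ ?_
      have : f (π.symm b) = b := π.apply_symm_apply b
      rw [this]
      exact hba
    have hinv : (M.submatrix π.symm id) * (M⁻¹.submatrix id π.symm) = 1 := by
      rw [← Matrix.submatrix_mul M M⁻¹ π.symm id π.symm Function.bijective_id,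
        Matrix.mul_nonsing_inv M hdet, Matrix.submatrix_one_equiv]
    let _ : Invertible (M⁻¹.submatrix id π.symm) := invertibleOfLeftInverse _ _ hinv
    have htri' := Matrix.blockTriangular_inv_of_blockTriangular htri
    rw [Matrix.inv_eq_left_inv hinv] at htri'
    obtain ⟨i, j, hlt, hne⟩ := hM.2 π
    refine hne ?_
    have := htri' (i := π i) (j := j) hlt
    simpa using this
  · simp only [Function.Injective, not_forall] at hinj
    obtain ⟨i, j, hij, hne⟩ := hinj
    exact ⟨i, j, f i, hne, hf i, hij ▸ hf j, fun s' h => ⟨hf' i s' h, hf' j s' (hij ▸ h)⟩⟩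

theorem vecMul_sub_eq_of_eq_off_pair {i j : Fin k} (hij : i ≠ j) {a a' : Fin k → F}
    (h : ∀ r, r ≠ i ∧ r ≠ j → a r = a' r) (s : Fin k) :
    Matrix.vecMul a M s - Matrix.vecMul a' M s =
      (a i - a' i) * M i s + (a j - a' j) * M j s := by
  classical
  simp only [Matrix.vecMul, dotProduct, ← Finset.sum_sub_distrib, ← sub_mul]
  rw [← Finset.sum_subset (Finset.subset_univ {i, j}), Finset.sum_pair hij]
  intro r _ hr
  simp only [Finset.mem_insert, Finset.mem_singleton, not_or] at hr
  rw [h r hr, sub_self, zero_mul]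

/-- In `a = (a M) M⁻¹`, the terms before `s` agree and those after `s` have coefficient zero. -/
theorem sub_eq_of_vecMul_eq (hM : IsUnit M) {s r : Fin k} (hr : ∀ s' > s, M⁻¹ s' r = 0)
    {a a' : Fin k → F} (h : ∀ s' < s, Matrix.vecMul a M s' = Matrix.vecMul a' M s') :
    a r - a' r = (Matrix.vecMul a M s - Matrix.vecMul a' M s) * M⁻¹ s r := by
  classical
  have hdet : IsUnit M.det := (Matrix.isUnit_iff_isUnit_det M).1 hM
  have e : ∀ a : Fin k → F, a r = ∑ s', Matrix.vecMul a M s' * M⁻¹ s' r := by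
    intro a
    change a r = Matrix.vecMul (Matrix.vecMul a M) M⁻¹ r
    rw [Matrix.vecMul_vecMul, Matrix.mul_nonsing_inv M hdet, Matrix.vecMul_one]
  rw [e a, e a', ← Finset.sum_sub_distrib, Finset.sum_eq_single s]
  · rw [sub_mul]
  · intro s' _ hs'
    rcases lt_or_gt_of_ne hs' with h1 | h1
    · rw [h s' h1, sub_self]
    · rw [hr s' h1, mul_zero, mul_zero, sub_self]
  · simp

end Mixing

theorem cent_iidWeight_pair {S 𝒲 F : Type*} [Fintype S] [Field F] {k : ℕ} {w : S → ℝ} (hw1 : ∑ s, w s = 1) {i j : Fin k} (hij : i ≠ j) (A : S → F)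
    (W : S → 𝒲) (α : F) :
    cent (iidWeight k w) (fun v => A (v i) + α * A (v j)) (fun v => (W (v i), W (v j))) =
      pairEnt w A W α := by
  rw [pairEnt, ← mass_iidWeight_pair hw1 hij]
  exact cent_comp _ (fun v : Fin k → S => (v i, v j)) (fun z => A z.1 + α * A z.2)
    fun z => (W z.1, W z.2)

theorem ent_iidWeight_pair {S γ : Type*} [Fintype S] {k : ℕ} {w : S → ℝ} (hw : ∀ s, 0 ≤ w s)
    (hw1 : ∑ s, w s = 1) {i j : Fin k} (hij : i ≠ j) (X : S → γ) :
    ent (iidWeight k w) (fun v => (X (v i), X (v j))) = 2 * ent w X := by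
  have e1 := ent_comp (iidWeight k w) (fun v => (v i, v j)) fun z => (X z.1, X z.2)
  have e2 := ent_comp (iidWeight 2 w) (fun v => (v 0, v 1)) fun z => (X z.1, X z.2)
  have e3 := ent_iidWeight_pi (k := 2) hw hw1 X
  rw [mass_iidWeight_pair hw1 hij] at e1
  rw [mass_iidWeight_pair hw1 zero_ne_one, ← e1] at e2
  rw [Nat.cast_two] at e3
  rw [← e2, ← e3]
  exact ent_congr _ fun v v' => by simp [funext_iff, Fin.forall_fin_two]

section Step

variable {S 𝒲 F : Type*} [Fintype S] [Fintype 𝒲] [Field F] [Fintype F] {k : ℕ}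
  {M : Matrix (Fin k) (Fin k) F} {w : S → ℝ}

/-- The conditional entropy `H(U_s | U_{<s}, W)` for `k` independent samples `(A_r, W_r)` and
`U = A M`. -/
def stepEnt (w : S → ℝ) (A : S → F) (W : S → 𝒲) (M : Matrix (Fin k) (Fin k) F) (s : Fin k) : ℝ :=
  cent (iidWeight k w) (fun v => Matrix.vecMul (fun r => A (v r)) M s)
    (fun v => (fun r => W (v r),
      fun s' : {s' // s' < s} => Matrix.vecMul (fun r => A (v r)) M s'.1))

/-- The chain rule telescopes from the entropy of all `W_r` to that of `(U, W)`, which determines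
and is determined by all `(A_r, W_r)`. -/
theorem sum_stepEnt {S 𝒲 F : Type*} [Fintype S] [Field F] {k : ℕ}
    {M : Matrix (Fin k) (Fin k) F} {w : S → ℝ} (hM : IsUnit M) (hw : ∀ s, 0 ≤ w s) (hw1 : ∑ s, w s = 1) (A : S → F)
    (W : S → 𝒲) : ∑ s, stepEnt w A W M s = k * cent w A W := by
  classical
  set U : (Fin k → S) → Fin k → F := fun v => Matrix.vecMul (fun r => A (v r)) M with hU
  set E : ℕ → ℝ := fun m => ent (iidWeight k w)
    (fun v => (fun r => W (v r), fun s' : {s' : Fin k // s'.1 < m} => U v s'.1)) with hE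
  have h1 : ∀ s : Fin k, stepEnt w A W M s = E (s + 1) - E s := by
    intro s
    simp only [stepEnt, cent, hE]
    congr 1
    refine ent_congr _ fun v v' => ?_
    simp only [Prod.mk.injEq, funext_iff, Subtype.forall]
    constructor
    · rintro ⟨h, hW, hlt⟩
      refine ⟨hW, fun a ha => ?_⟩
      rcases (Nat.lt_succ_iff_lt_or_eq.1 ha) with h2 | h2
      · exact hlt a h2
      · rw [Fin.ext h2]; exact h
    · rintro ⟨hW, h⟩
      exact ⟨h s (Nat.lt_succ_self _), hW, fun a ha => h a (Nat.lt_succ_of_lt ha)⟩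
  have h2 : E k = k * ent w fun s => (A s, W s) := by
    rw [← ent_iidWeight_pi hw hw1]
    refine ent_congr _ fun v v' => ?_
    simp only [Prod.mk.injEq, funext_iff, Subtype.forall]
    constructor
    · rintro ⟨hW, h⟩ r
      have := Matrix.vecMul_injective_of_isUnit hM (funext fun s => h s s.2)
      exact ⟨congr_fun this r, hW r⟩
    · intro h
      refine ⟨fun r => (h r).2, fun s _ => ?_⟩
      simp only [hU, fun r => (h r).1]
  have h3 : E 0 = k * ent w W := by
    rw [← ent_iidWeight_pi hw hw1]
    refine ent_congr _ fun v v' => ?_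
    simp [funext_iff]
  rw [Finset.sum_congr rfl fun s _ => h1 s, Fin.sum_univ_eq_sum_range (fun m => E (m + 1) - E m) k,
    Finset.sum_range_sub, h2, h3, cent, mul_sub]

/-- Revealing every sample except `A_i`, `A_j` can only lower the entropy. It fixes `U_{<s}`, where
both rows vanish, and leaves in `U_s` a known shift of `M i s * (A_i + α A_j)`. -/
theorem pairEnt_le_stepEnt (hw : ∀ s, 0 ≤ w s) (hw1 : ∑ s, w s = 1) (A : S → F) (W : S → 𝒲)
    {i j s : Fin k} (hij : i ≠ j) (hi : M i s ≠ 0) (h : ∀ s' < s, M i s' = 0 ∧ M j s' = 0) :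
    pairEnt w A W (M j s / M i s) ≤ stepEnt w A W M s := by
  classical
  set α := M j s / M i s with hα
  have e1 := ent_iidWeight_pair_prod hw hw1 hij (fun a b => (A a + α * A b, (W a, W b)))
    fun a => (A a, W a)
  have e2 := ent_iidWeight_pair_prod hw hw1 hij (fun a b => (W a, W b)) fun a => (A a, W a)
  -- The other samples are independent of the pair, so conditioning on them changes nothing.
  have e3 : cent (iidWeight k w) (fun v => A (v i) + α * A (v j)) (fun v => ((W (v i), W (v j)),
      fun r : {r // r ≠ i ∧ r ≠ j} => (A (v r), W (v r)))) = pairEnt w A W α := by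
    have e4 : ent (iidWeight k w) (fun v => (A (v i) + α * A (v j), ((W (v i), W (v j)),
        fun r : {r // r ≠ i ∧ r ≠ j} => (A (v r), W (v r))))) =
        ent (iidWeight k w) (fun v => ((A (v i) + α * A (v j), (W (v i), W (v j))),
          fun r : {r // r ≠ i ∧ r ≠ j} => (A (v r), W (v r)))) :=
      ent_congr _ fun v v' => by simp only [Prod.mk.injEq, and_assoc]
    rw [← cent_iidWeight_pair hw1 hij, cent, cent, e4, e1, e2, add_sub_add_right_eq_sub]
  rw [← e3, stepEnt]
  refine le_trans (le_of_eq ?_) (cent_anti (iidWeight_nonneg hw) _ (fun v => ((W (v i), W (v j)),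
      fun r : {r // r ≠ i ∧ r ≠ j} => (A (v r), W (v r)))) _ ?_)
  · refine cent_congr _ (fun _ _ => Iff.rfl) fun v v' hv => ?_
    simp only [Prod.mk.injEq, funext_iff, Subtype.forall] at hv
    have := vecMul_sub_eq_of_eq_off_pair (M := M) hij (a := fun r => A (v r))
      (a' := fun r => A (v' r)) (fun r hr => (hv.2 r hr).1) s
    have e5 : (A (v i) - A (v' i)) * M i s + (A (v j) - A (v' j)) * M j s =
        (A (v i) + α * A (v j) - (A (v' i) + α * A (v' j))) * M i s := by
      rw [hα]
      field_simp
      ring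
    rw [e5] at this
    rw [iff_comm, ← sub_eq_zero, this, mul_eq_zero, or_iff_left hi, sub_eq_zero]
  · intro v v' hv
    simp only [Prod.mk.injEq, funext_iff, Subtype.forall] at hv ⊢
    refine ⟨fun r => ?_, fun s' hs' => ?_⟩
    · by_cases hri : r = i
      · rw [hri]; exact hv.1.1
      by_cases hrj : r = j
      · rw [hrj]; exact hv.1.2
      exact (hv.2 r ⟨hri, hrj⟩).2
    · rw [← sub_eq_zero, vecMul_sub_eq_of_eq_off_pair hij fun r hr => (hv.2 r hr).1, (h s' hs').1,
        (h s' hs').2, mul_zero, mul_zero, add_zero]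

/-- Given `U_{<s}`, both `A_i` and `A_j` are affine in `U_s` with nonzero slope. Hence `A_i` is as
uncertain as `U_s`, and `α` is chosen to cancel `U_s` from `A_i + α A_j`, which is therefore already
known. Forgetting the rest leaves `H(A_i | A_i + α A_j, W_i, W_j)`. -/
theorem stepEnt_le (hM : IsUnit M) (hw : ∀ s, 0 ≤ w s) (hw1 : ∑ s, w s = 1) (A : S → F)
    (W : S → 𝒲) {i j s : Fin k} (hij : i ≠ j) (hi : M⁻¹ s i ≠ 0) (hj : M⁻¹ s j ≠ 0)
    (h : ∀ s' > s, M⁻¹ s' i = 0 ∧ M⁻¹ s' j = 0) :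
    stepEnt w A W M s ≤ 2 * cent w A W - pairEnt w A W (-(M⁻¹ s i / M⁻¹ s j)) := by
  classical
  set α := -(M⁻¹ s i / M⁻¹ s j) with hα
  have hα0 : α ≠ 0 := neg_ne_zero.2 (div_ne_zero hi hj)
  -- Chain rule: `(A_i, A_i + α A_j)` carries the same information as `(A_i, A_j)`.
  have e3 : cent (iidWeight k w) (fun v => A (v i))
      (fun v => (A (v i) + α * A (v j), (W (v i), W (v j)))) =
      2 * cent w A W - pairEnt w A W α := by
    rw [← cent_iidWeight_pair hw1 hij, cent, cent, cent, mul_sub,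
      ← ent_iidWeight_pair hw hw1 hij, ← ent_iidWeight_pair hw hw1 hij, sub_sub_sub_cancel_right]
    congr 1
    refine ent_congr _ fun v v' => ?_
    simp only [Prod.mk.injEq]
    constructor
    · rintro ⟨h1, h2, h3, h4⟩
      rw [h1, add_right_inj, mul_right_inj' hα0] at h2
      exact ⟨⟨h1, h3⟩, h2, h4⟩
    · rintro ⟨⟨h1, h3⟩, h2, h4⟩
      exact ⟨h1, by rw [h1, h2], h3, h4⟩
  rw [← e3, stepEnt]
  have hdiff : ∀ v v' : Fin k → S, ((fun r => W (v r), fun s' : {s' // s' < s} =>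
      Matrix.vecMul (fun r => A (v r)) M s'.1) : (Fin k → 𝒲) × ({s' // s' < s} → F)) =
      (fun r => W (v' r), fun s' : {s' // s' < s} => Matrix.vecMul (fun r => A (v' r)) M s'.1) →
      A (v i) - A (v' i) = (Matrix.vecMul (fun r => A (v r)) M s -
        Matrix.vecMul (fun r => A (v' r)) M s) * M⁻¹ s i ∧
      A (v j) - A (v' j) = (Matrix.vecMul (fun r => A (v r)) M s -
        Matrix.vecMul (fun r => A (v' r)) M s) * M⁻¹ s j := by
    intro v v' hv
    simp only [Prod.mk.injEq, funext_iff, Subtype.forall] at hv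
    exact ⟨sub_eq_of_vecMul_eq hM (fun s' hs' => (h s' hs').1) hv.2,
      sub_eq_of_vecMul_eq hM (fun s' hs' => (h s' hs').2) hv.2⟩
  refine le_trans (le_of_eq ?_) (cent_anti (iidWeight_nonneg hw) (fun v => A (v i))
    (fun v => (fun r => W (v r),
      fun s' : {s' // s' < s} => Matrix.vecMul (fun r => A (v r)) M s'.1)) _ ?_)
  · refine cent_congr _ (fun _ _ => Iff.rfl) fun v v' hv => ?_
    rw [← sub_eq_zero (a := A (v i)), (hdiff v v' hv).1, mul_eq_zero, or_iff_left hi, sub_eq_zero]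
  · intro v v' hv
    obtain ⟨h1, h2⟩ := hdiff v v' hv
    simp only [Prod.mk.injEq, funext_iff, Subtype.forall] at hv ⊢
    refine ⟨?_, hv.1 i, hv.1 j⟩
    rw [← sub_eq_zero, add_sub_add_comm, ← mul_sub, h1, h2, hα]
    field_simp
    ring

end Step

/-! ### Conditional entropies of discrete laws -/

section PMF

open Real

variable {S T γ δ : Type*}

/-- The real weights of a discrete law. -/
def realWeight (p : PMF S) (s : S) : ℝ := (p s).toReal

theorem realWeight_nonneg (p : PMF S) (s : S) : 0 ≤ realWeight p s := ENNReal.toReal_nonneg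

theorem sum_realWeight [Fintype S] (p : PMF S) : ∑ s, realWeight p s = 1 := by
  have h := p.tsum_coe
  rw [tsum_fintype] at h
  unfold realWeight
  rw [← ENNReal.toReal_sum fun s _ => p.apply_ne_top s, h, ENNReal.toReal_one]

theorem realWeight_iid (k : ℕ) (p : PMF S) : realWeight (iid k p) = iidWeight k (realWeight p) := by
  funext v
  exact ENNReal.toReal_prod Finset.univ fun r => p (v r)

theorem prob_eq_mass [Fintype S] (p : PMF S) (Z : S → γ) (z : γ) :
    prob p {s | Z s = z} = mass (realWeight p) Z z := by
  classical
  rw [prob, PMF.toOuterMeasure_apply, tsum_fintype,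
    ENNReal.toReal_sum fun s _ => ne_top_of_le_ne_top (p.apply_ne_top s)
      (Set.indicator_le_self _ _ s), mass_eq]
  refine Finset.sum_congr rfl fun s _ => ?_
  by_cases h : Z s = z <;> simp [h, realWeight, Set.indicator]

theorem condEntropy_eq_cent [Fintype S] [Fintype γ] [Fintype δ] (p : PMF S) (X : S → γ)
    (Y : S → δ) : condEntropy p X Y = cent (realWeight p) X Y / log 2 := by
  classical
  have : Nonempty γ := ⟨X p.support_nonempty.some⟩
  obtain ⟨κ, hκ, h⟩ := exists_kernel (realWeight_nonneg p) X Y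
  rw [cent_eq_sum_shannon _ X Y κ (fun y => (hκ y).2) h, condEntropy, tsum_fintype,
    Finset.sum_div]
  refine Finset.sum_congr rfl fun y _ => ?_
  rw [prob_eq_mass, mul_div_assoc]
  by_cases h0 : mass (realWeight p) Y y = 0
  · rw [h0, zero_mul, zero_mul]
  have hc : ∀ x, condProb p X Y x y = κ y x := by
    intro x
    have e : {s | X s = x ∧ Y s = y} = {s | (X s, Y s) = (x, y)} := by
      ext s; simp
    rw [condProb, e, prob_eq_mass p fun s => (X s, Y s), prob_eq_mass, h,
      mul_div_cancel_left₀ _ h0]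
  rw [shannon, Finset.sum_div]
  congr 1
  refine Finset.sum_congr rfl fun x _ => ?_
  rw [hc, logb, one_div, log_inv, negMulLog, neg_mul_comm, mul_div_assoc]

theorem condEntropy_map [Fintype γ] (p : PMF T) (f : T → S) (X : S → γ) (Y : S → δ) :
    condEntropy (p.map f) X Y = condEntropy p (fun s => X (f s)) (fun s => Y (f s)) := by
  have h : ∀ E : Set S, prob (p.map f) E = prob p (f ⁻¹' E) := fun E => by
    rw [prob, prob, PMF.toOuterMeasure_map_apply]
  simp only [condEntropy, condProb, h, Set.preimage_ofPred_eq]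

end PMF

/-! ### The Arıkan entropies -/

section Arikan

open Real

/-- The sums `∑ₓ C(y | x)` equal one nonzero constant and add up to `|F| < ∞` over all outputs.
Finiteness turns every entropy into a finite sum. -/
theorem IsSymmetricChannel.finite {F 𝒴 : Type*} [Fintype F] [Nonempty F] {C : F → PMF 𝒴}
    (hC : IsSymmetricChannel C) : Finite 𝒴 := by
  by_contra hfin
  rw [not_finite_iff_infinite] at hfin
  obtain ⟨a⟩ := ‹Nonempty F›
  obtain ⟨y, hy⟩ := (C a).support_nonempty
  have h1 : ∑' y', ∑ x, C x y' = Fintype.card F := by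
    rw [Summable.tsum_finsetSum fun _ _ => ENNReal.summable]
    simp [PMF.tsum_coe]
  have h2 : ∑ x, C x y ≠ 0 := by
    intro h
    exact hy (Finset.sum_eq_zero_iff.1 h a (Finset.mem_univ a))
  rw [tsum_congr fun y' => hC.2 y' y, ENNReal.tsum_const_eq_top_of_ne_zero h2] at h1
  exact ENNReal.natCast_ne_top _ h1.symm

theorem toLex_snoc_lt_toLex_snoc {k t : ℕ} (i j : MultiIndex k t) (a b : Fin k) :
    toLex (Fin.snoc i a : MultiIndex k (t + 1)) < toLex (Fin.snoc j b : MultiIndex k (t + 1)) ↔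
      toLex i < toLex j ∨ i = j ∧ a < b := by
  change (∃ l, (∀ l' < l, (Fin.snoc i a : MultiIndex k (t + 1)) l' =
    (Fin.snoc j b : MultiIndex k (t + 1)) l') ∧ (Fin.snoc i a : MultiIndex k (t + 1)) l <
    (Fin.snoc j b : MultiIndex k (t + 1)) l) ↔ (∃ l, (∀ l' < l, i l' = j l') ∧ i l < j l) ∨ _
  constructor
  · rintro ⟨l, h1, h2⟩
    induction l using Fin.lastCases with
    | last =>
      refine Or.inr ⟨funext fun l => ?_, by simpa using h2⟩
      simpa using h1 l.castSucc (Fin.castSucc_lt_last l)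
    | cast l =>
      refine Or.inl ⟨l, fun l' hl' => ?_, by simpa using h2⟩
      simpa using h1 l'.castSucc (Fin.castSucc_lt_castSucc_iff.2 hl')
  · rintro (⟨l, h1, h2⟩ | ⟨rfl, h⟩)
    · refine ⟨l.castSucc, fun l' hl' => ?_, by simpa using h2⟩
      obtain ⟨l'', rfl⟩ : ∃ l'', l' = Fin.castSucc l'' :=
        ⟨l'.castPred (Fin.ne_last_of_lt hl'), by simp⟩
      simpa using h1 l'' (Fin.castSucc_lt_castSucc_iff.1 hl')
    · refine ⟨Fin.last t, fun l' hl' => ?_, by simpa using h⟩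
      obtain ⟨l'', rfl⟩ : ∃ l'', l' = Fin.castSucc l'' :=
        ⟨l'.castPred (Fin.ne_last_of_lt hl'), by simp⟩
      simp

/-- The part of a sample from `D_t` that precedes the coordinate `j`. -/
def past {F 𝒴 : Type*} {k t : ℕ} (j : MultiIndex k t)
    (x : (MultiIndex k t → F) × (MultiIndex k t → 𝒴)) :
    ({m : MultiIndex k t // toLex m < toLex j} → F) × (MultiIndex k t → 𝒴) :=
  (fun m => x.1 m, x.2)

/-- The coordinates before `[j, s]` are the full blocks `[m, ·]` with `m ≺ j`, equivalent to the
`A⁽ʳ⁾_m` by invertibility, and the entries `[j, s']` with `s' < s`. This is exactly the conditioning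
in `stepEnt`. -/
theorem past_arikanStep_eq_iff {F 𝒴 : Type*} [Field F] {k t : ℕ} {M : Matrix (Fin k) (Fin k) F}
    (hM : IsUnit M) (j : MultiIndex k t) (s : Fin k)
    (v v' : Fin k → (MultiIndex k t → F) × (MultiIndex k t → 𝒴)) :
    past (Fin.snoc j s : MultiIndex k (t + 1)) (arikanStep M t v) =
        past (Fin.snoc j s : MultiIndex k (t + 1)) (arikanStep M t v') ↔
      ((fun r => past j (v r), fun s' : {s' // s' < s} =>
        Matrix.vecMul (fun r => (v r).1 j) M s'.1) :
        (Fin k → ({m : MultiIndex k t // toLex m < toLex j} → F) × (MultiIndex k t → 𝒴)) ×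
          ({s' // s' < s} → F)) =
      (fun r => past j (v' r), fun s' : {s' // s' < s} =>
        Matrix.vecMul (fun r => (v' r).1 j) M s'.1) := by
  simp only [past, arikanStep, Prod.mk.injEq, funext_iff, Subtype.forall]
  constructor
  · rintro ⟨hA, hB⟩
    refine ⟨fun r => ⟨fun m hm => ?_, fun m => ?_⟩, fun s' hs' => ?_⟩
    · have : ∀ a, Matrix.vecMul (fun r => (v r).1 m) M a = Matrix.vecMul (fun r => (v' r).1 m) M a :=
        fun a => by
          simpa using hA (Fin.snoc m a) ((toLex_snoc_lt_toLex_snoc m j a s).2 (Or.inl hm))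
      exact congr_fun (Matrix.vecMul_injective_of_isUnit hM (funext this)) r
    · simpa using hB (Fin.cons r m)
    · simpa using hA (Fin.snoc j s') ((toLex_snoc_lt_toLex_snoc j j s' s).2 (Or.inr ⟨rfl, hs'⟩))
  · rintro ⟨h1, h2⟩
    refine ⟨fun m hm => ?_, fun m => (h1 _).2 _⟩
    rw [← Fin.snoc_init_self m, toLex_snoc_lt_toLex_snoc] at hm
    rcases hm with hm | ⟨hm, hlt⟩
    · simp only [fun r => (h1 r).1 _ hm]
    · rw [hm]
      exact h2 _ hlt

section

variable {F 𝒴 : Type*} [Field F] [Fintype F] [Finite 𝒴] {k : ℕ} (M : Matrix (Fin k) (Fin k) F)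
  (C : F → PMF 𝒴)

theorem div_log_two_div_logb (x : ℝ) (n : ℕ) : x / log 2 / logb 2 n = x / log n := by
  have h2 : log 2 ≠ 0 := (log_pos one_lt_two).ne'
  rw [logb, div_div_div_cancel_right₀ h2]

instance fintypeSample (t : ℕ) : Fintype ((MultiIndex k t → F) × (MultiIndex k t → 𝒴)) := Fintype.ofFinite _

theorem arikanEntropy_eq (t : ℕ) (j : MultiIndex k t) :
    arikanEntropy M C t j =
      cent (realWeight (arikanLaw M C t)) (fun x => x.1 j) (past j) / log (Fintype.card F) := by
  have : Fintype (({m : MultiIndex k t // toLex m < toLex j} → F) × (MultiIndex k t → 𝒴)) :=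
    Fintype.ofFinite _
  rw [arikanEntropy, condEntropy_eq_cent, div_log_two_div_logb]
  rfl

theorem arikanEntropy_snoc_eq {M : Matrix (Fin k) (Fin k) F} (hM : IsUnit M) (t : ℕ)
    (j : MultiIndex k t) (s : Fin k) :
    arikanEntropy M C (t + 1) (Fin.snoc j s) =
      stepEnt (realWeight (arikanLaw M C t)) (fun x => x.1 j) (past j) M s /
        log (Fintype.card F) := by
  have : Fintype ({m : MultiIndex k (t + 1) // toLex m < toLex (Fin.snoc j s : MultiIndex k (t + 1))}
      → F) := Fintype.ofFinite _
  have : Fintype (MultiIndex k (t + 1) → 𝒴) := Fintype.ofFinite _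
  rw [arikanEntropy, arikanLaw, condEntropy_map, condEntropy_eq_cent, div_log_two_div_logb,
    realWeight_iid, stepEnt]
  congr 1
  have e : ∀ v : Fin k → (MultiIndex k t → F) × (MultiIndex k t → 𝒴),
      (arikanStep M t v).1 (Fin.snoc j s) = Matrix.vecMul (fun r => (v r).1 j) M s := fun v => by
    simp [arikanStep]
  simp only [e]
  exact cent_congr _ (fun v v' => past_arikanStep_eq_iff hM j s v v') fun v v' _ => Iff.rfl

end

/-! ### One-step bounds for the Arıkan entropies, uniform in `t` and `j` -/

section Prime

variable {q : ℕ} [Fact q.Prime] {𝒴 : Type*} [Finite 𝒴] {k : ℕ}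
  {M : Matrix (Fin k) (Fin k) (ZMod q)} (C : ZMod q → PMF 𝒴)

theorem arikanEntropy_mem_Icc (t : ℕ) (j : MultiIndex k t) :
    arikanEntropy M C t j ∈ Set.Icc (0 : ℝ) 1 := by
  have : Fintype (({m : MultiIndex k t // toLex m < toLex j} → ZMod q) × (MultiIndex k t → 𝒴)) :=
    Fintype.ofFinite _
  have hL : 0 < log q := log_prime_pos
  have h := cent_mem_Icc (realWeight_nonneg (arikanLaw M C t)) (sum_realWeight _)
    (fun x => x.1 j) (past j)
  rw [arikanEntropy_eq, ZMod.card]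
  exact ⟨div_nonneg h.1 hL.le, (div_le_one hL).2 h.2⟩

theorem sum_arikanEntropy_snoc (hM : IsUnit M) (t : ℕ) (j : MultiIndex k t) :
    ∑ s, arikanEntropy M C (t + 1) (Fin.snoc j s) = k * arikanEntropy M C t j := by
  simp only [arikanEntropy_snoc_eq C hM, ← Finset.sum_div]
  rw [sum_stepEnt hM (realWeight_nonneg _) (sum_realWeight _), arikanEntropy_eq, mul_div_assoc]

/-- Some step increases a moderate entropy by a fixed amount. -/
theorem exists_arikanEntropy_add_le (hM : IsMixing M) {τ : ℝ} (hτ : 0 < τ) :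
    ∃ ε > 0, ∀ (t : ℕ) (j : MultiIndex k t), arikanEntropy M C t j ∈ Set.Ioo τ (1 - τ) →
      ∃ s, arikanEntropy M C t j + ε ≤ arikanEntropy M C (t + 1) (Fin.snoc j s) := by
  have hL : 0 < log q := log_prime_pos
  obtain ⟨a, b, s, hab, ha, hb, h⟩ := hM.exists_rows
  obtain ⟨ε, hε, H⟩ := exists_cent_add_le_pairEnt (div_ne_zero hb ha) (mul_pos hτ hL)
  refine ⟨ε / log q, div_pos hε hL, fun t j hj => ⟨s, ?_⟩⟩
  have : Fintype (({m : MultiIndex k t // toLex m < toLex j} → ZMod q) × (MultiIndex k t → 𝒴)) :=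
    Fintype.ofFinite _
  rw [arikanEntropy_eq, ZMod.card] at hj
  rw [arikanEntropy_snoc_eq C hM.1, arikanEntropy_eq, ZMod.card, ← add_div]
  refine div_le_div_of_nonneg_right ?_ hL.le
  refine (H (realWeight_nonneg _) (sum_realWeight _) _ _ ?_ ?_).trans
    (pairEnt_le_stepEnt (realWeight_nonneg _) (sum_realWeight _) _ _ hab ha h)
  · exact ((lt_div_iff₀ hL).1 hj.1).le
  · have := (div_lt_iff₀ hL).1 hj.2
    linarith

/-- Some step divides a small entropy by any given factor. -/
theorem exists_arikanEntropy_le_div (hM : IsMixing M) {c : ℝ} (hc : 0 < c) :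
    ∃ τ > 0, ∀ (t : ℕ) (j : MultiIndex k t), arikanEntropy M C t j ≤ τ →
      ∃ s, arikanEntropy M C (t + 1) (Fin.snoc j s) ≤ arikanEntropy M C t j / c := by
  have hL : 0 < log q := log_prime_pos
  obtain ⟨a, b, s, hab, ha, hb, h⟩ := hM.exists_columns_inv
  obtain ⟨δ, hδ, H⟩ := exists_two_mul_cent_sub_pairEnt_le
    (neg_ne_zero.2 (div_ne_zero ha hb)) (inv_pos.2 hc)
  refine ⟨δ / log q, div_pos hδ hL, fun t j hj => ⟨s, ?_⟩⟩
  have : Fintype (({m : MultiIndex k t // toLex m < toLex j} → ZMod q) × (MultiIndex k t → 𝒴)) :=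
    Fintype.ofFinite _
  rw [arikanEntropy_eq, ZMod.card] at hj
  rw [arikanEntropy_snoc_eq C hM.1, arikanEntropy_eq, ZMod.card, div_right_comm]
  refine div_le_div_of_nonneg_right ?_ hL.le
  refine (stepEnt_le hM.1 (realWeight_nonneg _) (sum_realWeight _) _ _ hab ha hb h).trans ?_
  refine (H (realWeight_nonneg _) (sum_realWeight _) _ _ ?_).trans (le_of_eq ?_)
  · exact (div_le_div_iff_of_pos_right hL).1 hj
  · rw [div_eq_inv_mul]

/-- Some step divides a small entropy deficit by any given factor. -/
theorem exists_one_sub_arikanEntropy_le_div (hM : IsMixing M) {c : ℝ} (hc : 0 < c) :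
    ∃ τ > 0, ∀ (t : ℕ) (j : MultiIndex k t), 1 - arikanEntropy M C t j ≤ τ →
      ∃ s, 1 - arikanEntropy M C (t + 1) (Fin.snoc j s) ≤ (1 - arikanEntropy M C t j) / c := by
  have hL : 0 < log q := log_prime_pos
  have hq : (0 : ℝ) < q := by exact_mod_cast (Fact.out : q.Prime).pos
  obtain ⟨a, b, s, hab, ha, hb, h⟩ := hM.exists_rows
  -- In normalized units `1 - X' ≤ 16 q² log q (1 - X)²`, and this threshold makes one factor at
  -- most `c⁻¹`.
  refine ⟨(16 * q ^ 2 * log q * c)⁻¹, by positivity, fun t j hj => ⟨s, ?_⟩⟩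
  have : Fintype (({m : MultiIndex k t // toLex m < toLex j} → ZMod q) × (MultiIndex k t → 𝒴)) :=
    Fintype.ofFinite _
  have h0 := (arikanEntropy_mem_Icc (M := M) C t j).2
  have h1 := sub_pairEnt_le (div_ne_zero hb ha) (realWeight_nonneg (arikanLaw M C t))
    (sum_realWeight _) (fun x => x.1 j) (past j)
  have h2 := pairEnt_le_stepEnt (realWeight_nonneg (arikanLaw M C t)) (sum_realWeight _)
    (fun x => x.1 j) (past j) hab ha h
  have e1 : cent (realWeight (arikanLaw M C t)) (fun x => x.1 j) (past j) =
      arikanEntropy M C t j * log q := by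
    rw [arikanEntropy_eq, ZMod.card, div_mul_cancel₀ _ hL.ne']
  have e2 : stepEnt (realWeight (arikanLaw M C t)) (fun x => x.1 j) (past j) M s =
      arikanEntropy M C (t + 1) (Fin.snoc j s) * log q := by
    rw [arikanEntropy_snoc_eq C hM.1, ZMod.card, div_mul_cancel₀ _ hL.ne']
  rw [e1] at h1
  rw [e2] at h2
  set X := arikanEntropy M C t j
  set X' := arikanEntropy M C (t + 1) (Fin.snoc j s)
  have h3 : (1 - X') * log q ≤ (16 * q ^ 2 * log q * (1 - X)) * (1 - X) * log q := by
    nlinarith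
  have h4 := le_of_mul_le_mul_right h3 hL
  have h5 : 16 * q ^ 2 * log q * (1 - X) ≤ c⁻¹ := by
    calc 16 * q ^ 2 * log q * (1 - X) ≤ 16 * q ^ 2 * log q * (16 * q ^ 2 * log q * c)⁻¹ := by
          gcongr
      _ = c⁻¹ := by field_simp
  rw [div_eq_inv_mul]
  exact h4.trans (mul_le_mul_of_nonneg_right h5 (sub_nonneg.2 h0))

end Prime

end Arikan

/-! ### Conditioning on the past of a uniform sequence -/

section CondExp

variable {Ω α : Type*} [MeasurableSpace Ω] {μ : Measure Ω} [IsProbabilityMeasure μ] {k : ℕ}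
  [Finite α] [MeasurableSpace α] [DiscreteMeasurableSpace α] {P : Ω → α} {I : Ω → Fin k}

theorem integrable_comp_of_finite (hP : Measurable P) (f : α → ℝ) :
    Integrable (fun ω => f (P ω)) μ := by
  obtain ⟨B, hB⟩ := (Set.finite_range fun a => ‖f a‖).bddAbove
  exact Integrable.of_bound ((Measurable.of_discrete (f := f)).comp hP).aestronglyMeasurable B
    (.of_forall fun ω => hB ⟨P ω, rfl⟩)

/-- The conditional expectation given `P` of a function of `P` and of an independent uniform index
is the average over that index. -/
theorem condExp_comp_uniform (hP : Measurable P) (hI : Measurable I) (hPI : IndepFun P I μ)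
    (hu : ∀ s, μ {ω | I ω = s} = (k : ENNReal)⁻¹) (φ : α → Fin k → ℝ) :
    μ[fun ω => φ (P ω) (I ω) | MeasurableSpace.comap P inferInstance] =ᵐ[μ]
      fun ω => (k : ℝ)⁻¹ * ∑ s, φ (P ω) s := by
  have hm := hP.comap_le
  set ind : Fin k → Ω → ℝ := fun s ω => if I ω = s then 1 else 0 with hind
  have hindm : ∀ s, StronglyMeasurable[MeasurableSpace.comap I inferInstance] (ind s) := fun s =>
    ((Measurable.of_discrete (f := fun i : Fin k => if i = s then (1 : ℝ) else 0)).comp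
      (comap_measurable I)).stronglyMeasurable
  have hindi : ∀ s, Integrable (ind s) μ := fun s =>
    integrable_comp_of_finite hI fun i => if i = s then (1 : ℝ) else 0
  have hφm : ∀ s, StronglyMeasurable[MeasurableSpace.comap P inferInstance]
      fun ω => φ (P ω) s := fun s =>
    ((Measurable.of_discrete (f := fun a => φ a s)).comp (comap_measurable P)).stronglyMeasurable
  have hmean : ∀ s, μ[ind s] = (k : ℝ)⁻¹ := by
    intro s
    have e : ind s = {ω | I ω = s}.indicator 1 := by
      funext ω
      by_cases h : I ω = s <;> simp [hind, h, Set.indicator]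
    have hs : MeasurableSet {ω | I ω = s} := hI (measurableSet_singleton s)
    rw [e, integral_indicator_one hs, measureReal_def, hu]
    simp
  have hsum : (fun ω => φ (P ω) (I ω)) = ∑ s, (fun ω => φ (P ω) s) * ind s := by
    funext ω
    simp [hind]
  have hmul : ∀ s, Integrable ((fun ω => φ (P ω) s) * ind s) μ := fun s =>
    integrable_comp_of_finite (hP.prodMk hI) fun z : α × Fin k =>
      φ z.1 s * if z.2 = s then (1 : ℝ) else 0
  have hone : ∀ s, μ[(fun ω => φ (P ω) s) * ind s | MeasurableSpace.comap P inferInstance] =ᵐ[μ]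
      fun ω => φ (P ω) s * (k : ℝ)⁻¹ := by
    intro s
    have h1 := condExp_mul_of_stronglyMeasurable_left (hφm s) (hmul s) (hindi s)
    have h2 := condExp_indep_eq hI.comap_le hm (hindm s) ((IndepFun_iff_Indep _ _ _).1 hPI).symm
    filter_upwards [h1, h2] with ω e1 e2
    rw [e1, Pi.mul_apply, e2, hmean]
  rw [hsum]
  refine (condExp_finsetSum (fun s _ => hmul s) _).trans ?_
  filter_upwards [ae_all_iff.2 hone] with ω h
  rw [Finset.sum_apply, Finset.sum_congr rfl fun s _ => h s, ← Finset.sum_mul, mul_comm]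

/-- A lower bound on the averages gives a lower bound on the conditional expectation. -/
theorem ae_le_condExpGiven (hP : Measurable P) (hI : Measurable I) (hPI : IndepFun P I μ)
    (hu : ∀ s, μ {ω | I ω = s} = (k : ENNReal)⁻¹) {φ : α → Fin k → ℝ} (hφ : ∀ a s, 0 ≤ φ a s)
    (ψ : α → ℝ) {E : Set ℝ} (hE : MeasurableSet E) {θ : ℝ}
    (h : ∀ a, ψ a ∈ E → θ ≤ (k : ℝ)⁻¹ * ∑ s, φ a s) :
    ∀ᵐ ω ∂μ, ψ (P ω) ∈ E →
      θ ≤ condExpGiven μ (fun ω => φ (P ω) (I ω)) (fun ω => ψ (P ω)) ω := by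
  classical
  have hψ : Measurable fun ω => ψ (P ω) := Measurable.of_discrete.comp hP
  have hle : MeasurableSpace.comap (fun ω => ψ (P ω)) inferInstance ≤
      MeasurableSpace.comap P inferInstance :=
    ((Measurable.of_discrete (f := ψ)).comp (comap_measurable P)).comap_le
  -- `g` depends on `ψ(P)` alone and lies below the conditional expectation given `P`, off `E`
  -- because `φ ≥ 0`. The tower property passes the bound to the coarser conditioning.
  set g : Ω → ℝ := fun ω => E.indicator (fun _ => θ) (ψ (P ω)) with hg
  have hgm : StronglyMeasurable[MeasurableSpace.comap (fun ω => ψ (P ω)) inferInstance] g :=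
    ((measurable_const.indicator hE).comp (comap_measurable _)).stronglyMeasurable
  have hgi : Integrable g μ := integrable_comp_of_finite hP fun a => E.indicator (fun _ => θ) (ψ a)
  have h1 := condExp_comp_uniform hP hI hPI hu φ
  have h2 : g ≤ᵐ[μ] μ[fun ω => φ (P ω) (I ω) | MeasurableSpace.comap P inferInstance] := by
    filter_upwards [h1] with ω e
    rw [e]
    by_cases hω : ψ (P ω) ∈ E
    · simpa [hg, hω] using h _ hω
    · simp only [hg, Set.indicator_of_notMem hω]
      exact mul_nonneg (by positivity) (Finset.sum_nonneg fun s _ => hφ _ _)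
  have h3 := condExp_mono (m := MeasurableSpace.comap (fun ω => ψ (P ω)) inferInstance) hgi
    integrable_condExp h2
  have h4 := condExp_condExp_of_le (μ := μ) (f := fun ω => φ (P ω) (I ω)) hle hP.comap_le
  rw [condExp_of_stronglyMeasurable hψ.comap_le hgm hgi] at h3
  filter_upwards [h3, h4] with ω e3 e4 hω
  rw [e4] at e3
  simpa [hg, hω, condExpGiven] using e3

end CondExp

section UniformIID

variable {Ω : Type*} [MeasurableSpace Ω] {μ : Measure Ω} {k : ℕ} {i : ℕ → Ω → Fin k}

theorem IsUniformIID.measurable_prefix (hi : IsUniformIID μ i) (t : ℕ) :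
    Measurable fun ω (s : Fin t) => i s ω :=
  measurable_pi_lambda _ fun s => hi.1 s

theorem IsUniformIID.indepFun_prefix (hi : IsUniformIID μ i) (t : ℕ) :
    IndepFun (fun ω (s : Fin t) => i s ω) (i t) μ := by
  have h := hi.2.1.indepFun_finset (Finset.range t) {t} (by simp) hi.1
  exact h.comp (φ := fun f (s : Fin t) => f ⟨s, Finset.mem_range.2 s.2⟩)
    (ψ := fun f => f ⟨t, Finset.mem_singleton_self t⟩)
    (measurable_pi_lambda _ fun s => measurable_pi_apply _) .of_discrete

theorem snoc_prefix {Ω : Type*} {k : ℕ} (i : ℕ → Ω → Fin k) (t : ℕ) (ω : Ω) :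
    (fun s : Fin (t + 1) => i s ω) = Fin.snoc (fun s : Fin t => i s ω) (i t ω) := by
  funext s
  induction s using Fin.lastCases <;> simp

end UniformIID

/-- A process that is a function of a uniform sequence and is preserved on average by each step is a
`[0,1]`-martingale. -/
theorem isUnitMartingale_of_average {Ω : Type*} [MeasurableSpace Ω] {μ : Measure Ω}
    [IsProbabilityMeasure μ] {k : ℕ} {i : ℕ → Ω → Fin k} (hi : IsUniformIID μ i) (hk : k ≠ 0)
    (X : (t : ℕ) → MultiIndex k t → ℝ) (h01 : ∀ t j, X t j ∈ Set.Icc (0 : ℝ) 1)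
    (hsum : ∀ t j, ∑ s, X (t + 1) (Fin.snoc j s) = k * X t j) :
    IsUnitMartingale μ fun t ω => X t fun s => i s ω := by
  have hm : ∀ t, StronglyMeasurable fun ω => X t fun s => i s ω := fun t =>
    ((Measurable.of_discrete (f := X t)).comp (hi.measurable_prefix t)).stronglyMeasurable
  have hint : ∀ t, Integrable (fun ω => X t fun s => i s ω) μ := fun t =>
    integrable_comp_of_finite (hi.measurable_prefix t) (X t)
  refine ⟨fun t ω => h01 t _, hm, ?_⟩
  have hadp := Filtration.stronglyAdapted_natural hm
  refine martingale_nat hadp hint fun t => ?_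
  -- The past of the process is coarser than that of the indices, so the tower property transfers
  -- the identity.
  have hle : Filtration.natural (fun t ω => X t fun s => i s ω) hm t ≤
      MeasurableSpace.comap (fun ω (s : Fin t) => i s ω) inferInstance := by
    refine iSup₂_le fun t' ht' => Measurable.comap_le ?_
    have : Measurable[MeasurableSpace.comap (fun ω (s : Fin t) => i s ω) inferInstance]
        fun ω (s : Fin t') => i s ω :=
      (measurable_pi_lambda (fun (f : Fin t → Fin k) (s : Fin t') => f (Fin.castLE ht' s))
        fun s => measurable_pi_apply _).comp (comap_measurable _)
    exact (Measurable.of_discrete (f := X t')).comp this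
  have h1 := condExp_comp_uniform (hi.measurable_prefix t) (hi.1 t) (hi.indepFun_prefix t)
    (hi.2.2 t) fun j s => X (t + 1) (Fin.snoc j s)
  have h2 : μ[fun ω => X (t + 1) fun s => i s ω |
      MeasurableSpace.comap (fun ω (s : Fin t) => i s ω) inferInstance] =ᵐ[μ]
      fun ω => X t fun s => i s ω := by
    simp only [snoc_prefix i t]
    refine h1.trans (.of_forall fun ω => ?_)
    simp only [hsum]
    rw [inv_mul_cancel_left₀ (Nat.cast_ne_zero.2 hk)]
  have h3 := condExp_condExp_of_le (μ := μ) (f := fun ω => X (t + 1) fun s => i s ω) hle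
    (hi.measurable_prefix t).comap_le
  have h4 := condExp_congr_ae (m := Filtration.natural (fun t ω => X t fun s => i s ω) hm t) h2
  rw [condExp_of_stronglyMeasurable (Filtration.le _ t) (hadp t) (hint t)] at h4
  exact h4.symm.trans h3

/-- Some step from each index satisfies a relation, so the step to a uniform index satisfies it with
conditional probability at least `k⁻¹`. -/
theorem ae_le_condProbGiven {Ω : Type*} [MeasurableSpace Ω] {μ : Measure Ω}
    [IsProbabilityMeasure μ] {k : ℕ} {i : ℕ → Ω → Fin k} (hi : IsUniformIID μ i)
    (X : (t : ℕ) → MultiIndex k t → ℝ) (t : ℕ) {E : Set ℝ} (hE : MeasurableSet E)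
    (R : ℝ → ℝ → Prop) (h : ∀ j, X t j ∈ E → ∃ s, R (X t j) (X (t + 1) (Fin.snoc j s))) :
    ∀ᵐ ω ∂μ, (X t fun s => i s ω) ∈ E →
      (k : ℝ)⁻¹ ≤ condProbGiven μ {ω' | R (X t fun s => i s ω') (X (t + 1) fun s => i s ω')}
        (fun ω => X t fun s => i s ω) ω := by
  classical
  have h1 := ae_le_condExpGiven (hi.measurable_prefix t) (hi.1 t) (hi.indepFun_prefix t)
    (hi.2.2 t) (φ := fun j s => if R (X t j) (X (t + 1) (Fin.snoc j s)) then 1 else 0)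
    (fun j s => by split_ifs <;> norm_num) (X t) hE (θ := (k : ℝ)⁻¹) ?_
  · have e : ({ω' | R (X t fun s => i s ω') (X (t + 1) fun s => i s ω')}.indicator fun _ =>
        (1 : ℝ)) = fun ω => if R (X t fun s => i s ω)
          (X (t + 1) (Fin.snoc (fun s : Fin t => i s ω) (i t ω))) then 1 else 0 := by
      funext ω
      simp only [Set.indicator, Set.mem_ofPred_eq, snoc_prefix i t]
    rw [condProbGiven, e]
    exact h1
  · intro j hj
    obtain ⟨s, hs⟩ := h j hj
    refine le_mul_of_one_le_right (by positivity) ?_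
    have := Finset.single_le_sum
      (f := fun s => if R (X t j) (X (t + 1) (Fin.snoc j s)) then (1 : ℝ) else 0)
      (fun s _ => by split_ifs <;> norm_num) (Finset.mem_univ s)
    simpa [hs] using this

end Polar
end

theorem theorem1p10 (q : ℕ) [Fact q.Prime] (k : ℕ) (M : Matrix (Fin k) (Fin k) (ZMod q))
    (hM : Polar.IsMixing M) {𝒴 : Type*} (C : ZMod q → PMF 𝒴) (hC : Polar.IsSymmetricChannel C)
    {Ω : Type*} [MeasurableSpace Ω] (μ : Measure Ω) [IsProbabilityMeasure μ]
    (i : ℕ → Ω → Fin k) (hi : Polar.IsUniformIID μ i) :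
    Polar.LocallyPolarizing μ (Polar.arikanMartingale M C i) := by
  have hfin := hC.finite
  have hk : k ≠ 0 := by
    rintro rfl
    obtain ⟨a, -⟩ := hM.2 1
    exact a.elim0
  have hk0 : (0 : ℝ) < (k : ℝ)⁻¹ := inv_pos.2 (Nat.cast_pos.2 (Nat.pos_of_ne_zero hk))
  refine ⟨Polar.isUnitMartingale_of_average hi hk (Polar.arikanEntropy M C)
    (Polar.arikanEntropy_mem_Icc C) (Polar.sum_arikanEntropy_snoc C hM.1), fun τ hτ => ?_,
    (k : ℝ)⁻¹, hk0, fun c hc => ?_⟩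
  · obtain ⟨ε, hε, h⟩ := Polar.exists_arikanEntropy_add_le C hM hτ
    -- One index of probability `1/k` moves the entropy by at least `ε`.
    refine ⟨(k : ℝ)⁻¹ * ε ^ 2, by positivity, fun t => ?_⟩
    have h1 := Polar.ae_le_condExpGiven (hi.measurable_prefix t) (hi.1 t) (hi.indepFun_prefix t)
      (hi.2.2 t) (φ := fun j s =>
        (Polar.arikanEntropy M C (t + 1) (Fin.snoc j s) - Polar.arikanEntropy M C t j) ^ 2)
      (fun j s => sq_nonneg _) (Polar.arikanEntropy M C t) (E := Set.Ioo τ (1 - τ))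
      measurableSet_Ioo (θ := (k : ℝ)⁻¹ * ε ^ 2) ?_
    · simp only [← Polar.snoc_prefix i t] at h1
      exact h1
    · intro j hj
      obtain ⟨s, hs⟩ := h t j hj
      refine mul_le_mul_of_nonneg_left ?_ hk0.le
      refine le_trans ?_ (Finset.single_le_sum (f := fun s =>
        (Polar.arikanEntropy M C (t + 1) (Fin.snoc j s) - Polar.arikanEntropy M C t j) ^ 2)
        (fun s _ => sq_nonneg _) (Finset.mem_univ s))
      exact pow_le_pow_left₀ hε.le (by linarith) 2
  · obtain ⟨τ₁, hτ₁, h₁⟩ := Polar.exists_arikanEntropy_le_div C hM hc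
    obtain ⟨τ₂, hτ₂, h₂⟩ := Polar.exists_one_sub_arikanEntropy_le_div C hM hc
    refine ⟨min τ₁ τ₂, lt_min hτ₁ hτ₂, fun t => ⟨?_, ?_⟩⟩
    · exact Polar.ae_le_condProbGiven hi (Polar.arikanEntropy M C) t
        (E := {x | x ≤ min τ₁ τ₂}) (measurableSet_le measurable_id measurable_const)
        (fun x x' => x' ≤ x / c) fun j hj => h₁ t j (hj.trans (min_le_left _ _))
    · exact Polar.ae_le_condProbGiven hi (Polar.arikanEntropy M C) t
        (E := {x | 1 - x ≤ min τ₁ τ₂})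
        (measurableSet_le (measurable_const.sub measurable_id) measurable_const)
        (fun x x' => 1 - x' ≤ (1 - x) / c) fun j hj => h₂ t j (hj.trans (min_le_right _ _))
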